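/- Let $0\le k<n$ and let $W\subseteq\mathbb R^n$ be a $(k+1)$-dimensional subspace that is totally positive, i.e. $W$ is the row span of a $(k+1)\times n$ real matrix all of whose maximal minors are positive. Let $\mathrm{Gr}_{k,n}^{\ge 0}$ be the set of $k$-dimensional subspaces of $\mathbb R^n$ that are row spans of rank-$k$ matrices of size $k\times n$ with all maximal minors nonnegative, and let $$\mathcal B_{n,k,1}(W)=\{V^\perp\cap W : V\in \mathrm{Gr}_{k,n}^{\ge 0}\}.$$ For a sign vector $\sigma\in\{0,+,-\}^n$ let $\mathrm{var}(\sigma)$ be its number of sign changes, ignoring zeros ($\mathrm{var}(0)=-1$), and let $\overline{\mathrm{var}}(\sigma)$ be the maximum of $\mathrm{var}(\tau)$ over all $\tau\in\{0,+,-\}^n$ with $\tau_i=\sigma_i$ whenever $\sigma_i\ne 0$. For each nonzero $\sigma$ with $\overline{\mathrm{var}}(\sigma)=k$, taken modulo multiplication by $\pm1$, let the stratum $\mathcal B_\sigma(W)$ be the set of lines $\langle w\rangle$ with $w\in W\setminus\{0\}$ and $\mathrm{sign}(w)=\pm\sigma$; its dimension $\dim \mathcal B_\sigma(W)$ is the dimension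 of the smallest projective subspace of $\mathbb P(\mathbb R^n)$ containing it. The strata are nonempty and partition $\mathcal B_{n,k,1}(W)$, and $$\sum_{\text{strata } S \text{ of } \mathcal B_{n,k,1}(W)} q^{\dim S}=\sum_{i=0}^k\binom{n-k-1+i}{i}\binom{n}{k-i}q^i=\sum_{j=0}^k\binom{n-k-1+j}{j}(1+q)^j .$$ Moreover $\mathcal B_{n,k,1}(W)$ has the structure of a finite CW complex whose open $d$-cells are exactly the $d$-dimensional strata, and its Euler characteristic (the alternating sum of the numbers of cells) is consequently $1$. -/

import Mathlib

noncomputable section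

namespace Amplituhedron

/-! ### Sign vectors and sign variation -/

open Classical in
/-- The number of times a sign vector changes sign when zeros are ignored: the number of pairs
`i < j` of positions with opposite nonzero signs and only zeros strictly between them.
By convention it is `-1` for the zero vector. -/
def var {n : ℕ} (σ : Fin n → SignType) : ℤ :=
  if σ = 0 then -1
  else ((Finset.univ.filter fun p : Fin n × Fin n =>
    p.1 < p.2 ∧ σ p.1 ≠ 0 ∧ σ p.2 = -σ p.1 ∧ ∀ l, p.1 < l → l < p.2 → σ l = 0).card : ℤ)

open Classical in
/-- The maximum of `var τ` over all `τ` that agree with `σ` at the nonzero positions of `σ`. -/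
def varBar {n : ℕ} (σ : Fin n → SignType) : ℤ :=
  (Finset.univ.filter fun τ : Fin n → SignType => ∀ i, σ i ≠ 0 → τ i = σ i).sup'
    ⟨σ, by simp⟩ var

/-- The sign vector of a vector of `ℝⁿ`. -/
def signVec {n : ℕ} (w : EuclideanSpace ℝ (Fin n)) : Fin n → SignType :=
  fun i => SignType.sign (w i)

/-! ### Subspaces of `ℝⁿ`, total positivity, the amplituhedron -/

/-- The usual topology on linear subspaces of `ℝⁿ` (on each Grassmannian it is the usual one):
subspaces are close when the orthogonal projections onto them are. -/
instance instTopologicalSpaceSubspaces {n : ℕ} :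
    TopologicalSpace (Submodule ℝ (EuclideanSpace ℝ (Fin n))) :=
  TopologicalSpace.induced (fun V => V.starProjection) inferInstance

/-- `V` is the row span of the full-rank `k × n` matrix `A`. -/
def IsRowSpan {k n : ℕ} (A : Matrix (Fin k) (Fin n) ℝ)
    (V : Submodule ℝ (EuclideanSpace ℝ (Fin n))) : Prop :=
  LinearIndependent ℝ A.row ∧ Submodule.span ℝ (Set.range fun i => WithLp.toLp 2 (A i)) = V

/-- The totally nonnegative Grassmannian: `k`-dimensional subspaces of `ℝⁿ` whose Plücker
coordinates are all nonnegative, for a suitable choice of the common scalar factor. -/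
def grNonneg (k n : ℕ) : Set (Submodule ℝ (EuclideanSpace ℝ (Fin n))) :=
  {V | ∃ A : Matrix (Fin k) (Fin n) ℝ, IsRowSpan A V ∧
    ∀ I : Fin k ↪o Fin n, 0 ≤ (A.submatrix id I).det}

/-- The totally positive Grassmannian: all Plücker coordinates are positive. -/
def grPos (k n : ℕ) : Set (Submodule ℝ (EuclideanSpace ℝ (Fin n))) :=
  {V | ∃ A : Matrix (Fin k) (Fin n) ℝ, IsRowSpan A V ∧
    ∀ I : Fin k ↪o Fin n, 0 < (A.submatrix id I).det}

/-- The amplituhedron `B_{n,k,m}(W) = {V^⊥ ∩ W : V ∈ Gr_{k,n}^{≥0}}`, for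
`W ∈ Gr_{k+m,n}^{>0}`. -/
def amplituhedron {n : ℕ} (k : ℕ) (W : Submodule ℝ (EuclideanSpace ℝ (Fin n))) :
    Set (Submodule ℝ (EuclideanSpace ℝ (Fin n))) :=
  {X | ∃ V ∈ grNonneg k n, X = Vᗮ ⊓ W}

/-! ### The stratification for `m = 1` -/

/-- The stratum `B_σ(W)`: the lines spanned by nonzero `w ∈ W` with `sign(w) = ±σ`. -/
def stratum {n : ℕ} (W : Submodule ℝ (EuclideanSpace ℝ (Fin n))) (σ : Fin n → SignType) :
    Set (Submodule ℝ (EuclideanSpace ℝ (Fin n))) :=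
  {X | ∃ w ∈ W, w ≠ 0 ∧ (signVec w = σ ∨ signVec w = -σ) ∧ X = Submodule.span ℝ {w}}

/-- The strata of `B_{n,k,1}(W)`: the sets `B_σ(W)`, where `σ` runs over the nonzero sign vectors
with `varBar σ = k`. Since `B_σ(W) = B_{-σ}(W)`, the index is only relevant modulo `±1`. -/
def strata {n : ℕ} (k : ℕ) (W : Submodule ℝ (EuclideanSpace ℝ (Fin n))) :
    Set (Set (Submodule ℝ (EuclideanSpace ℝ (Fin n)))) :=
  {S | ∃ σ : Fin n → SignType, σ ≠ 0 ∧ varBar σ = k ∧ S = stratum W σ}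

theorem strata_finite {n : ℕ} (k : ℕ) (W : Submodule ℝ (EuclideanSpace ℝ (Fin n))) :
    (strata k W).Finite :=
  (Set.finite_range (stratum W)).subset (by rintro S ⟨σ, -, -, rfl⟩; exact ⟨σ, rfl⟩)

/-- The dimension of a nonempty set `S` of lines through the origin which is a face, that is, the
projectivization of a convex cone: the dimension of the smallest projective subspace containing
`S`. -/
def dim {n : ℕ} (S : Set (Submodule ℝ (EuclideanSpace ℝ (Fin n)))) : ℕ :=
  Module.finrank ℝ ↥(sSup S) - 1

/-- The generating function `∑_S q^{dim S}` over the strata `S` of `B_{n,k,1}(W)`. -/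
def genFun {n : ℕ} (k : ℕ) (W : Submodule ℝ (EuclideanSpace ℝ (Fin n))) : Polynomial ℕ :=
  ∑ S ∈ (strata_finite k W).toFinset, Polynomial.X ^ dim S

/-! ### Euler characteristic -/

/-- The Euler characteristic of a finite CW complex: the alternating sum of its numbers of
cells. -/
def eulerChar {Y : Type*} [TopologicalSpace Y] (C : Set Y) [Topology.CWComplex C] : ℤ :=
  ∑ᶠ d : ℕ, (-1) ^ d * (Nat.card (Topology.CWComplex.cell C d) : ℤ)

end Amplituhedron

end

/-! The engine is a duality for sign vectors. If `altSign` flips the signs at odd positions, then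
`varBar σ` and the number of sign changes of `altSign σ` add up to n - 1 for σ ≠ 0 (`varBar_eq`),
because between neighbouring nonzero entries exactly one of the two sequences changes sign. A
maximum over all fillings of zeros becomes an ordinary count.

Two bounds of Gantmakher–Krein type then meet at k. A nonzero vector of the totally positive W has
`varBar` at most k, since otherwise a vanishing determinant, expanded along one row, would be a sum
of terms of one sign (`varBar_lt_of_mem_grPos`). A nonzero vector orthogonal to a totally
nonnegative V has `varBar` at least k: for totally positive V one pairs it with a vector of V of
matching signs, and the general case follows by multiplying V by a totally positive matrix close to
the identity (`le_varBar_of_mem_orthogonal_grNonneg`). So `varBar` is constantly k on the nonzero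
vectors of Vᗮ ⊓ W. This forces a line, as in a larger space a small perturbation could lower
`varBar` (`inf_eq_span_singleton`). Conversely, a vector of W with `varBar` equal to k is orthogonal
to an explicit V (`exists_grNonneg_orthogonal`). Hence the amplituhedron is the set of lines of W
with `varBar` equal to k.

Every such sign vector occurs in W (`exists_mem_signVec_eq`), and its zeros impose independent
conditions, so a stratum has dimension k minus the number of zeros. By the duality one has to count
sign vectors with n - k - 1 changes and a given number of zeros, an elementary count; the second
formula follows by the hockey-stick identity.

For the cell structure, each stratum is the interior of a compact convex slice of a cone in W. At a
boundary point further coordinates vanish, which cannot lower `varBar`, while membership in W keeps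
it at most k; so the boundary lies in strata of smaller dimension (`exists_characteristic_map`).
Setting q = -1 in the second formula leaves only the term j = 0, which is 1. -/

noncomputable section

namespace Amplituhedron

/-! ### Sign changes and the duality under alternation -/

/-- The number of sign changes of the sequence `a, s 0, s 1, …`, ignoring zeros. -/
def signChanges : (n : ℕ) → SignType → (Fin n → SignType) → ℕ
  | 0, _, _ => 0
  | n + 1, a, s =>
    if s 0 = 0 then signChanges n a (Fin.tail s)
    else (if s 0 = -a then 1 else 0) + signChanges n (s 0) (Fin.tail s)

/-- The sign vector with the signs at odd positions flipped. -/
def altSign {n : ℕ} (s : Fin n → SignType) : Fin n → SignType := fun i => (-1) ^ (i : ℕ) * s i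

theorem signChanges_succ {n : ℕ} (a : SignType) (s : Fin (n + 1) → SignType) :
    signChanges (n + 1) a s = if s 0 = 0 then signChanges n a (Fin.tail s)
      else (if s 0 = -a then 1 else 0) + signChanges n (s 0) (Fin.tail s) := rfl

theorem signChanges_cons {n : ℕ} (a b : SignType) (s : Fin n → SignType) :
    signChanges (n + 1) a (Fin.cons b s) = if b = 0 then signChanges n a s
      else (if b = -a then 1 else 0) + signChanges n b s := by
  rw [signChanges_succ]; simp

theorem signChanges_neg (n : ℕ) (a : SignType) (s : Fin n → SignType) :
    signChanges n (-a) (-s) = signChanges n a s := by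
  induction n generalizing a with
  | zero => rfl
  | succ n ih =>
    have ht : Fin.tail (-s) = -Fin.tail s := rfl
    have h0 : (-s) 0 = -s 0 := rfl
    rw [signChanges_succ, signChanges_succ, ht, ih, h0, ih]
    simp [neg_eq_iff_eq_neg]

theorem signChanges_zero (n : ℕ) (a : SignType) : signChanges n a 0 = 0 := by
  induction n with
  | zero => rfl
  | succ n ih => rw [signChanges_succ]; exact (if_pos rfl).trans ih

theorem SignType.ne_neg {a : SignType} (ha : a ≠ 0) : a ≠ -a := by
  revert a; decide

theorem SignType.eq_or_eq_neg {a b : SignType} (ha : a ≠ 0) (hb : b ≠ 0) : b = a ∨ b = -a := by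
  revert a b; decide

theorem signChanges_zero_le (n : ℕ) (a : SignType) (s : Fin n → SignType) :
    signChanges n 0 s ≤ signChanges n a s := by
  induction n with
  | zero => rfl
  | succ n ih =>
    rw [signChanges_succ, signChanges_succ]
    split_ifs <;> simp_all

theorem signChanges_le_succ_zero (n : ℕ) (a : SignType) (s : Fin n → SignType) :
    signChanges n a s ≤ signChanges n 0 s + 1 := by
  induction n with
  | zero => exact Nat.zero_le _
  | succ n ih =>
    rw [signChanges_succ, signChanges_succ]
    split_ifs <;> first | exact ih _ | omega

theorem signChanges_le_succ (n : ℕ) (a b : SignType) (s : Fin n → SignType) :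
    signChanges n a s ≤ signChanges n b s + 1 :=
  (signChanges_le_succ_zero n a s).trans (by grw [signChanges_zero_le n b s])

/-- The first nonzero sign. -/
theorem exists_lead {n : ℕ} (s : Fin n → SignType) (hs : s ≠ 0) :
    ∃ a : SignType, a ≠ 0 ∧ signChanges n a s = signChanges n 0 s ∧
      signChanges n (-a) s = signChanges n 0 s + 1 := by
  induction n with
  | zero => exact absurd (Subsingleton.elim _ _) hs
  | succ n ih =>
    by_cases h0 : s 0 = 0
    · have : Fin.tail s ≠ 0 := by
        intro h; apply hs; funext i
        refine Fin.cases h0 (fun j => congrFun h j) i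
      obtain ⟨a, ha, h1, h2⟩ := ih _ this
      exact ⟨a, ha, by simpa [signChanges_succ, h0] using h1,
        by simpa [signChanges_succ, h0] using h2⟩
    · refine ⟨s 0, h0, ?_, ?_⟩
      · have : s 0 ≠ -s 0 := SignType.ne_neg h0
        simp [signChanges_succ, h0, this]
      · simp [signChanges_succ, h0, add_comm]

/-- `τ` agrees with `σ` wherever `σ` is nonzero. -/
def Refines {n : ℕ} (τ σ : Fin n → SignType) : Prop := ∀ i, σ i ≠ 0 → τ i = σ i

theorem Refines.tail {n : ℕ} {τ σ : Fin (n + 1) → SignType} (h : Refines τ σ) :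
    Refines (Fin.tail τ) (Fin.tail σ) := fun i hi => h i.succ hi

theorem Refines.cons {n : ℕ} {τ : Fin n → SignType} {σ : Fin (n + 1) → SignType}
    (h : Refines τ (Fin.tail σ)) {b : SignType} (hb : σ 0 ≠ 0 → b = σ 0) :
    Refines (Fin.cons b τ : Fin (n + 1) → SignType) σ := by
  intro i
  refine Fin.cases (fun h0 => ?_) (fun j hj => ?_) i
  · rw [Fin.cons_zero, hb h0]
  · rw [Fin.cons_succ, h j hj]; rfl

theorem Refines.altSign {n : ℕ} {τ σ : Fin n → SignType} (h : Refines τ σ) :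
    Refines (altSign τ) (altSign σ) := by
  intro i hi
  have : σ i ≠ 0 := by rintro h0; simp [Amplituhedron.altSign, h0] at hi
  simp [Amplituhedron.altSign, h i this]

/-- Filling a zero with the preceding sign changes nothing; filling it with the opposite sign
creates one change and destroys at most one later. -/
theorem Refines.signChanges_le {n : ℕ} {τ σ : Fin n → SignType} (h : Refines τ σ)
    (a : SignType) : signChanges n a σ ≤ signChanges n a τ := by
  induction n generalizing a with
  | zero => rfl
  | succ n ih =>
    rw [signChanges_succ, signChanges_succ]
    by_cases h0 : σ 0 = 0
    · rw [if_pos h0]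
      by_cases h1 : τ 0 = 0
      · rw [if_pos h1]; exact ih h.tail a
      · rw [if_neg h1]
        by_cases ha : a = 0
        · subst ha
          exact (ih h.tail 0).trans ((signChanges_zero_le _ _ _).trans (Nat.le_add_left _ _))
        · rcases SignType.eq_or_eq_neg ha h1 with h2 | h2
          · rw [h2]; exact (ih h.tail a).trans (Nat.le_add_left _ _)
          · rw [if_pos h2]
            exact (ih h.tail a).trans ((signChanges_le_succ _ _ _ _).trans (by rw [add_comm]))
    · rw [h 0 h0, if_neg h0, if_neg h0]
      exact Nat.add_le_add_left (ih h.tail _) _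

/-- The sign a sits at the virtual position -1, which is odd, so alternation turns it into -a. The
tail alternates with the opposite phase, which a global sign absorbs. -/
theorem signChanges_altSign_succ {n : ℕ} (a : SignType) (s : Fin (n + 1) → SignType) :
    signChanges (n + 1) (-a) (altSign s) =
      if s 0 = 0 then signChanges n a (altSign (Fin.tail s))
      else (if s 0 = a then 1 else 0) + signChanges n (-s 0) (altSign (Fin.tail s)) := by
  have h0 : altSign s 0 = s 0 := by simp [altSign]
  have ht : Fin.tail (altSign s) = -altSign (Fin.tail s) := by
    funext i; simp [altSign, Fin.tail, pow_succ]
  rw [signChanges_succ, h0, ht, signChanges_neg, neg_neg, ← signChanges_neg n (s 0) _, neg_neg]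

/-- At a nonzero entry of σ exactly one of the two sequences changes sign. At a zero of σ only τ can
gain, so each of the n steps contributes at most one. -/
theorem signChanges_add_altSign_le {n : ℕ} {τ σ : Fin n → SignType} (h : Refines τ σ)
    {a : SignType} (ha : a ≠ 0) :
    signChanges n a τ + signChanges n (-a) (altSign σ) ≤ n := by
  induction n generalizing a with
  | zero => simp [signChanges]
  | succ n ih =>
    rw [signChanges_altSign_succ, signChanges_succ]
    have hna : -a ≠ 0 := by simpa using ha
    by_cases h0 : σ 0 = 0
    · rw [if_pos h0]
      have hI := ih h.tail hna
      rw [neg_neg] at hI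
      by_cases h1 : τ 0 = 0
      · rw [if_pos h1]
        have := signChanges_le_succ n a (-a) (Fin.tail τ)
        omega
      · rw [if_neg h1]
        rcases SignType.eq_or_eq_neg ha h1 with h2 | h2
        · have : τ 0 ≠ -a := by rw [h2]; exact SignType.ne_neg ha
          have := signChanges_le_succ n a (-a) (Fin.tail τ)
          rw [if_neg ‹_›, h2]; omega
        · rw [if_pos h2, h2]; omega
    · have hI := ih h.tail h0
      rw [if_neg h0, if_neg (by rwa [h 0 h0]), h 0 h0]
      have : (if σ 0 = -a then 1 else 0) + (if σ 0 = a then 1 else 0) ≤ 1 := by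
        revert ha; generalize σ 0 = x; revert x a; decide
      omega

theorem exists_refines_signChanges {n : ℕ} (σ : Fin n → SignType) {a : SignType} (ha : a ≠ 0) :
    ∃ τ, Refines τ σ ∧ signChanges n a τ + signChanges n (-a) (altSign σ) = n := by
  induction n generalizing a with
  | zero => exact ⟨σ, fun _ _ => rfl, by simp [signChanges]⟩
  | succ n ih =>
    have hna : -a ≠ 0 := by simpa using ha
    by_cases h0 : σ 0 = 0
    · obtain ⟨τ, hτ, he⟩ := ih (Fin.tail σ) hna
      -- Greedy filling: a zero receives the opposite of the preceding sign, so that every step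
      -- contributes exactly one change.
      refine ⟨Fin.cons (-a) τ, ?_, ?_⟩
      · exact hτ.cons fun h => absurd h0 h
      · rw [signChanges_altSign_succ, signChanges_cons, if_pos h0, if_neg hna, if_pos rfl]
        rw [neg_neg] at he; omega
    · obtain ⟨τ, hτ, he⟩ := ih (Fin.tail σ) h0
      refine ⟨Fin.cons (σ 0) τ, ?_, ?_⟩
      · exact hτ.cons fun _ => rfl
      · rw [signChanges_altSign_succ, signChanges_cons, if_neg h0, if_neg h0]
        have : (if σ 0 = -a then 1 else 0) + (if σ 0 = a then 1 else 0) = 1 := by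
          revert ha h0; generalize σ 0 = x; revert x a; decide
        omega

theorem tail_ne_zero {n : ℕ} {s : Fin (n + 1) → SignType} (hs : s ≠ 0) (h0 : s 0 = 0) :
    Fin.tail s ≠ 0 := by
  intro h; apply hs; funext i
  exact Fin.cases h0 (fun j => congrFun h j) i

theorem altSign_ne_zero {n : ℕ} {s : Fin n → SignType} (hs : s ≠ 0) : altSign s ≠ 0 := by
  obtain ⟨i, hi⟩ := Function.ne_iff.1 hs
  refine Function.ne_iff.2 ⟨i, ?_⟩
  simpa [altSign, pow_ne_zero] using hi

theorem altSign_altSign {n : ℕ} (s : Fin n → SignType) : altSign (altSign s) = s := by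
  funext i
  simp only [altSign, ← mul_assoc, ← mul_pow]
  simp

theorem altSign_neg {n : ℕ} (s : Fin n → SignType) : altSign (-s) = -altSign s := by
  funext i; simp [altSign]

/-- Without a preceding sign, the first nonzero entry of τ produces no change; this is the lost
unit. -/
theorem signChanges_zero_add_altSign_le {n : ℕ} {τ σ : Fin n → SignType} (h : Refines τ σ)
    (hσ : σ ≠ 0) : signChanges n 0 τ + signChanges n 0 (altSign σ) + 1 ≤ n := by
  induction n with
  | zero => exact absurd (Subsingleton.elim _ _) hσ
  | succ n ih =>
    have he := signChanges_altSign_succ 0 σ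
    rw [neg_zero] at he
    rw [he, signChanges_succ]
    by_cases h0 : σ 0 = 0
    · rw [if_pos h0]
      by_cases h1 : τ 0 = 0
      · rw [if_pos h1]
        have := ih h.tail (tail_ne_zero hσ h0)
        omega
      · rw [if_neg h1, if_neg (by simpa using h1)]
        have := signChanges_add_altSign_le h.tail h1
        have := signChanges_zero_le n (-τ 0) (altSign (Fin.tail σ))
        omega
    · have hI := signChanges_add_altSign_le h.tail h0
      rw [if_neg h0, if_neg (by rwa [h 0 h0]), h 0 h0, if_neg (by simpa using h0), if_neg h0]
      omega

theorem exists_refines_signChanges_zero {n : ℕ} (σ : Fin n → SignType) (hσ : σ ≠ 0) :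
    ∃ τ, Refines τ σ ∧ signChanges n 0 τ + signChanges n 0 (altSign σ) + 1 = n := by
  cases n with
  | zero => exact absurd (Subsingleton.elim _ _) hσ
  | succ n =>
    have he := signChanges_altSign_succ 0 σ
    rw [neg_zero] at he
    by_cases h0 : σ 0 = 0
    -- The head of τ is chosen so that its alternated counterpart a agrees with the leading sign of
    -- the alternated tail and adds no change there.
    · obtain ⟨a, ha, h1, -⟩ := exists_lead _ (altSign_ne_zero (tail_ne_zero hσ h0))
      have hna : -a ≠ 0 := by simpa using ha
      obtain ⟨τ, hτ, ht⟩ := exists_refines_signChanges (Fin.tail σ) hna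
      refine ⟨Fin.cons (-a) τ, ?_, ?_⟩
      · exact hτ.cons fun h => absurd h0 h
      · rw [he, signChanges_cons, if_pos h0, if_neg hna, if_neg (by simpa using ha)]
        rw [neg_neg] at ht; omega
    · obtain ⟨τ, hτ, ht⟩ := exists_refines_signChanges (Fin.tail σ) h0
      refine ⟨Fin.cons (σ 0) τ, ?_, ?_⟩
      · exact hτ.cons fun _ => rfl
      · rw [he, signChanges_cons, if_neg h0, if_neg h0, if_neg (by simpa using h0), if_neg h0]
        omega

/-! ### Comparison with `var` and `varBar` -/

open Classical in
-- The first count is 0 or 1: whether the first nonzero entry is opposite to a. It vanishes for a =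
-- 0, leaving the pairs counted by `var`.
theorem signChanges_eq_card {n : ℕ} (a : SignType) (s : Fin n → SignType) :
    signChanges n a s =
      (Finset.univ.filter fun j : Fin n => a ≠ 0 ∧ s j = -a ∧ ∀ l, l < j → s l = 0).card +
      (Finset.univ.filter fun p : Fin n × Fin n =>
        p.1 < p.2 ∧ s p.1 ≠ 0 ∧ s p.2 = -s p.1 ∧ ∀ l, p.1 < l → l < p.2 → s l = 0).card := by
  induction n generalizing a with
  | zero => simp [signChanges]
  | succ n ih =>
    simp only [Finset.card_filter, Fintype.sum_prod_type] at ih ⊢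
    rw [signChanges_succ]
    simp only [Fin.sum_univ_succ, Fin.forall_fin_succ, Fin.succ_pos, Fin.succ_lt_succ_iff,
      Fin.not_lt_zero, lt_self_iff_false, false_and, if_false, true_and, true_imp_iff,
      false_imp_iff, zero_add, implies_true, and_true]
    by_cases h0 : s 0 = 0
    · rw [if_pos h0, ih]
      have h1 : (a ≠ 0 ∧ s 0 = -a) ↔ False := by
        rw [h0]
        simp [eq_comm]
      rw [if_neg (h1.not.2 id)]
      simp only [h0, Fin.tail, if_false, zero_add, ne_eq, not_true, true_and, false_and,
        Finset.sum_const_zero]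
      congr!
    · have hz : ∀ j : Fin n, (a ≠ 0 ∧ s j.succ = -a ∧ s 0 = 0 ∧ ∀ i : Fin n, i < j → s i.succ = 0)
          ↔ False := fun j => by simp [h0]
      have hh : (a ≠ 0 ∧ s 0 = -a) ↔ s 0 = -a := by
        revert h0; clear ih hz; generalize s 0 = x; revert x a; decide
      rw [if_neg h0, ih]
      simp only [hz, hh, Fin.tail, if_false, Finset.sum_const_zero, add_zero]
      congr!

theorem var_eq_signChanges {n : ℕ} {σ : Fin n → SignType} (hσ : σ ≠ 0) :
    var σ = signChanges n 0 σ := by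
  rw [var, if_neg hσ, signChanges_eq_card]
  simp

theorem Refines.varBar_le {n : ℕ} {τ σ : Fin n → SignType} (h : Refines τ σ) :
    varBar τ ≤ varBar σ := by
  classical
  refine Finset.sup'_le _ _ fun ρ hρ => Finset.le_sup' var ?_
  simp only [Finset.mem_filter, Finset.mem_univ, true_and] at hρ ⊢
  intro i hi
  rw [hρ i (by rwa [h i hi]), h i hi]

/-- This is the duality: the upper bound holds for every filling, and the greedy filling attains it.
-/
theorem varBar_eq {n : ℕ} {σ : Fin n → SignType} (hσ : σ ≠ 0) :
    varBar σ = (n : ℤ) - 1 - signChanges n 0 (altSign σ) := by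
  classical
  have hne : ∀ τ, Refines τ σ → τ ≠ 0 := by
    rintro τ h rfl
    obtain ⟨i, hi⟩ := Function.ne_iff.1 hσ
    exact hi (h i hi).symm
  apply le_antisymm
  · refine Finset.sup'_le _ _ fun τ hτ => ?_
    simp only [Finset.mem_filter, Finset.mem_univ, true_and] at hτ
    rw [var_eq_signChanges (hne τ hτ)]
    have := signChanges_zero_add_altSign_le hτ hσ
    omega
  · obtain ⟨τ, hτ, he⟩ := exists_refines_signChanges_zero σ hσ
    refine le_trans ?_ (Finset.le_sup' var (b := τ) ?_)
    · rw [var_eq_signChanges (hne τ hτ)]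
      omega
    · simpa [Refines] using hτ

/-! ### Alternating positions -/

theorem exists_alternating_of_ne_zero {n : ℕ} (s : Fin n → SignType) {a : SignType} (ha : a ≠ 0) :
    ∃ f : Fin (signChanges n a s) → Fin n, StrictMono f ∧
      ∀ j, s (f j) = (-1) ^ (j : ℕ) * -a := by
  induction n generalizing a with
  | zero => exact ⟨Fin.elim0, fun i => i.elim0, fun i => i.elim0⟩
  | succ n ih =>
    by_cases h0 : s 0 = 0
    · obtain ⟨f, hf, h⟩ := ih (Fin.tail s) ha
      rw [show signChanges (n + 1) a s = signChanges n a (Fin.tail s) by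
        rw [signChanges_succ, if_pos h0]]
      exact ⟨fun j => (f j).succ, fun i j hij => Fin.succ_lt_succ_iff.2 (hf hij), h⟩
    · obtain ⟨f, hf, h⟩ := ih (Fin.tail s) h0
      rcases SignType.eq_or_eq_neg ha h0 with h1 | h1
      · have h2 : s 0 ≠ -a := by rw [h1]; exact SignType.ne_neg ha
        rw [show signChanges (n + 1) a s = signChanges n (s 0) (Fin.tail s) by
          rw [signChanges_succ, if_neg h0, if_neg h2, zero_add]]
        refine ⟨fun j => (f j).succ, fun i j hij => Fin.succ_lt_succ_iff.2 (hf hij), ?_⟩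
        rw [← h1]; exact h
      · rw [show signChanges (n + 1) a s = signChanges n (s 0) (Fin.tail s) + 1 by
          rw [signChanges_succ, if_neg h0, if_pos h1, add_comm]]
        refine ⟨Fin.cons 0 (fun j => (f j).succ), ?_, ?_⟩
        · intro i j
          refine Fin.cases ?_ (fun i => ?_) i <;> refine Fin.cases ?_ (fun j => ?_) j
          · simp
          · simp
          · simp
          · intro hij
            simpa using hf (Fin.succ_lt_succ_iff.1 hij)
        · intro j
          refine Fin.cases ?_ (fun j => ?_) j
          · simpa using h1
          · have := h j
            simp only [Fin.tail] at this
            simp [this, h1, pow_succ]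

theorem exists_alternating {n : ℕ} (s : Fin n → SignType) (hs : s ≠ 0) {m : ℕ}
    (hm : m ≤ signChanges n 0 s) :
    ∃ (f : Fin (m + 1) ↪o Fin n) (a : SignType), a ≠ 0 ∧ ∀ j, s (f j) = (-1) ^ (j : ℕ) * a := by
  -- Prefixing the opposite of the leading sign adds one change at the first nonzero entry, so m
  -- changes yield m + 1 alternating positions.
  obtain ⟨a, ha, -, h⟩ := exists_lead s hs
  have hna : -a ≠ 0 := by simpa using ha
  obtain ⟨f, hf, h2⟩ := exists_alternating_of_ne_zero s hna
  have hle : m + 1 ≤ signChanges n (-a) s := by omega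
  refine ⟨OrderEmbedding.ofStrictMono (fun j => f (Fin.castLE hle j))
    (fun i j hij => hf (by simpa using hij)), a, ha, fun j => ?_⟩
  rw [neg_neg] at h2
  exact h2 (Fin.castLE hle j)

/-- Flipping the leading sign produces an additional sign change. -/
theorem signChanges_lt_of_lead {n : ℕ} {τ σ : Fin n → SignType} (h : Refines τ σ) (i : Fin n)
    (hτ : ∀ j < i, τ j = 0) {a : SignType} (hi : τ i = a)
    (hσ : signChanges n a σ = signChanges n 0 σ + 1) (hσi : σ i = 0) :
    signChanges n 0 σ + 1 ≤ signChanges n 0 τ := by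
  induction n with
  | zero => exact i.elim0
  | succ n ih =>
    by_cases ha : a = 0
    · subst ha; omega
    induction i using Fin.cases with
    | zero =>
      rw [signChanges_succ 0 τ, if_neg (by rwa [hi]), if_neg (by simpa [hi] using ha), hi]
      rw [signChanges_succ, if_pos hσi] at hσ ⊢
      have := h.tail.signChanges_le a
      rw [signChanges_succ, if_pos hσi] at hσ
      omega
    | succ i =>
      have h0 : τ 0 = 0 := hτ 0 (Fin.succ_pos i)
      have h0' : σ 0 = 0 := by
        by_contra hc; exact hc (by rw [← h 0 hc, h0])
      rw [signChanges_succ, if_pos h0'] at hσ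
      rw [signChanges_succ, if_pos h0'] at hσ
      rw [signChanges_succ, if_pos h0', signChanges_succ, if_pos h0]
      exact ih h.tail i (fun j hj => hτ j.succ (Fin.succ_lt_succ_iff.2 hj)) hi hσ hσi

/-! ### Counting sign vectors -/

open Classical in
/-- The number of zeros of a sign vector. -/
def zeros {n : ℕ} (σ : Fin n → SignType) : ℕ := (Finset.univ.filter fun i => σ i = 0).card

theorem zeros_cons {n : ℕ} (b : SignType) (s : Fin n → SignType) :
    zeros (Fin.cons b s : Fin (n + 1) → SignType) = (if b = 0 then 1 else 0) + zeros s := by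
  simp only [zeros, Finset.card_filter, Fin.sum_univ_succ, Fin.cons_zero, Fin.cons_succ]

theorem zeros_zero (n : ℕ) : zeros (0 : Fin n → SignType) = n := by
  simp [zeros]

theorem zeros_altSign {n : ℕ} (s : Fin n → SignType) : zeros (altSign s) = zeros s := by
  simp [zeros, altSign]

open Classical in
theorem sum_signVec_succ {M : Type*} [AddCommMonoid M] {n : ℕ}
    (F : (Fin (n + 1) → SignType) → M) :
    ∑ s, F s = ∑ t : Fin n → SignType, (F (Fin.cons 0 t) + F (Fin.cons 1 t) +
      F (Fin.cons (-1) t)) := by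
  rw [← (Fin.consEquiv fun _ => SignType).sum_comp, Fintype.sum_prod_type_right]
  refine Finset.sum_congr rfl fun t _ => ?_
  rw [show (Finset.univ : Finset SignType) = {0, 1, -1} by decide]
  rw [Finset.sum_insert (by decide), Finset.sum_insert (by decide), Finset.sum_singleton]
  simp [Fin.consEquiv, add_assoc]

open Classical in
-- Choose the zeros, the first nonzero sign, and which of the n - z - 1 gaps between nonzero entries
-- carry a change.
theorem card_signChanges (n m z : ℕ) :
    ∑ s : Fin n → SignType, (if s ≠ 0 ∧ signChanges n 0 s = m ∧ zeros s = z then 1 else 0) =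
      if z < n then 2 * (n.choose z * (n - z - 1).choose m) else 0 := by
  induction n generalizing m z with
  | zero =>
    rw [if_neg (by omega)]
    exact Finset.sum_eq_zero fun s _ => if_neg fun h => h.1 (Subsingleton.elim _ _)
  | succ n ih =>
    rw [sum_signVec_succ]
    have hc : ∀ (b : SignType) (t : Fin n → SignType),
        (Fin.cons b t : Fin (n + 1) → SignType) ≠ 0 ↔ b ≠ 0 ∨ t ≠ 0 := by
      intro b t
      exact Matrix.cons_nonzero_iff
    -- Split by the head. A zero head uses up one zero; of the two nonzero heads, one agrees with
    -- the leading sign of t and the other adds a change. For t = 0 there is no leading sign, and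
    -- both nonzero heads give no change.
    have key : ∀ t : Fin n → SignType,
        ((if (Fin.cons 0 t : Fin (n + 1) → SignType) ≠ 0 ∧ signChanges (n + 1) 0 (Fin.cons 0 t) = m
            ∧ zeros (Fin.cons 0 t : Fin (n + 1) → SignType) = z then 1 else 0) +
          (if (Fin.cons 1 t : Fin (n + 1) → SignType) ≠ 0 ∧ signChanges (n + 1) 0 (Fin.cons 1 t) = m
            ∧ zeros (Fin.cons 1 t : Fin (n + 1) → SignType) = z then 1 else 0) +
          (if (Fin.cons (-1) t : Fin (n + 1) → SignType) ≠ 0 ∧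
            signChanges (n + 1) 0 (Fin.cons (-1) t) = m
            ∧ zeros (Fin.cons (-1) t : Fin (n + 1) → SignType) = z then 1 else 0)) =
        (if 0 < z then (if t ≠ 0 ∧ signChanges n 0 t = m ∧ zeros t = z - 1 then 1 else 0) else 0) +
        (if t ≠ 0 ∧ signChanges n 0 t = m ∧ zeros t = z then 1 else 0) +
        (if 0 < m then (if t ≠ 0 ∧ signChanges n 0 t = m - 1 ∧ zeros t = z then 1 else 0) else 0) +
        (if t = 0 then (if m = 0 ∧ z = n then 2 else 0) else 0) := by
      intro t
      simp only [hc, signChanges_cons, zeros_cons]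
      by_cases ht : t = 0
      · subst ht
        simp [signChanges_zero, zeros_zero, eq_comm]
        split_ifs <;> simp_all
      · obtain ⟨a, ha, h1, h2⟩ := exists_lead t ht
        have h3 : (signChanges n 1 t = signChanges n 0 t ∧
            signChanges n (-1) t = signChanges n 0 t + 1) ∨
            (signChanges n (-1) t = signChanges n 0 t ∧
            signChanges n 1 t = signChanges n 0 t + 1) := by
          rcases SignType.eq_or_eq_neg (a := 1) (by decide) ha with rfl | rfl
          · exact Or.inl ⟨h1, h2⟩
          · exact Or.inr ⟨h1, by simpa using h2⟩
        simp only [ne_eq, ht, not_false_eq_true, or_true, true_and, if_true, if_false, add_zero,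
          neg_zero]
        simp only [show ((1 : SignType) = 0) ↔ False by decide,
          show ((-1 : SignType) = 0) ↔ False by decide, if_false, zero_add]
        rcases h3 with ⟨h3, h4⟩ | ⟨h3, h4⟩ <;> rw [h3, h4] <;> split_ifs <;> omega
    rw [Finset.sum_congr rfl fun t _ => key t]
    simp only [Finset.sum_add_distrib]
    rw [Finset.sum_ite_eq' Finset.univ (0 : Fin n → SignType), if_pos (Finset.mem_univ _), ih]
    have e1 : (∑ t : Fin n → SignType, if 0 < z then
        (if t ≠ 0 ∧ signChanges n 0 t = m ∧ zeros t = z - 1 then 1 else 0) else 0) =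
        if 0 < z then (if z - 1 < n then 2 * (n.choose (z - 1) * (n - (z - 1) - 1).choose m)
          else 0) else 0 := by
      split_ifs <;> simp_all
    have e2 : (∑ t : Fin n → SignType, if 0 < m then
        (if t ≠ 0 ∧ signChanges n 0 t = m - 1 ∧ zeros t = z then 1 else 0) else 0) =
        if 0 < m then (if z < n then 2 * (n.choose z * (n - z - 1).choose (m - 1))
          else 0) else 0 := by
      split_ifs <;> simp_all
    rw [e1, e2]
    clear e1 e2 key ih hc
    rcases lt_trichotomy z n with h | rfl | h
    · obtain ⟨d, rfl⟩ := Nat.exists_eq_add_of_lt h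
      have h1 : z < z + d + 1 + 1 := by omega
      have h2 : z - 1 < z + d + 1 := by omega
      have h3 : ¬ (m = 0 ∧ z = z + d + 1) := by omega
      simp only [h, h1, h2, h3, if_true, if_false, show z + d + 1 - z - 1 = d by omega,
        show z + d + 1 + 1 - z - 1 = d + 1 by omega]
      rcases z with _ | z
      · rcases m with _ | m <;> simp [Nat.choose_succ_succ] <;> ring
      · simp only [show z + 1 + d + 1 - (z + 1 - 1) - 1 = d + 1 by omega]
        rcases m with _ | m <;> simp [Nat.choose_succ_succ] <;> ring
    · rcases z with _ | z <;> rcases m with _ | m <;> simp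
      ring
    · have h1 : ¬ z < n + 1 := by omega
      have h2 : ¬ z - 1 < n := by omega
      have h3 : ¬ (m = 0 ∧ z = n) := by omega
      have h4 : ¬ z < n := by omega
      simp [h1, h2, h3, h4]

section

open Filter Topology

/-! ### Row spans -/

theorem IsRowSpan.mem_iff {k n : ℕ} {A : Matrix (Fin k) (Fin n) ℝ}
    {V : Submodule ℝ (EuclideanSpace ℝ (Fin n))} (h : IsRowSpan A V)
    (w : EuclideanSpace ℝ (Fin n)) :
    w ∈ V ↔ ∃ c : Fin k → ℝ, Matrix.vecMul c A = WithLp.ofLp w := by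
  rw [← h.2, Submodule.mem_span_range_iff_exists_fun]
  refine exists_congr fun c => ?_
  rw [← (WithLp.ofLp_injective 2).eq_iff]
  refine Eq.congr_left ?_
  ext i
  simp [Matrix.vecMul, dotProduct]

theorem IsRowSpan.mem_orthogonal_iff {k n : ℕ} {A : Matrix (Fin k) (Fin n) ℝ}
    {V : Submodule ℝ (EuclideanSpace ℝ (Fin n))} (h : IsRowSpan A V)
    (w : EuclideanSpace ℝ (Fin n)) :
    w ∈ Vᗮ ↔ Matrix.mulVec A (WithLp.ofLp w) = 0 := by
  rw [← h.2, Submodule.mem_orthogonal]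
  constructor
  · intro hw
    funext i
    have := hw _ (Submodule.subset_span ⟨i, rfl⟩)
    rw [PiLp.inner_apply] at this
    simpa [Matrix.mulVec, dotProduct, mul_comm] using this
  · intro hw u hu
    induction hu using Submodule.span_induction with
    | mem x hx =>
      obtain ⟨i, rfl⟩ := hx
      have := congrFun hw i
      rw [PiLp.inner_apply]
      simpa [Matrix.mulVec, dotProduct, mul_comm] using this
    | zero => simp
    | add x y _ _ hx hy => rw [inner_add_left, hx, hy, add_zero]
    | smul a x _ hx => rw [inner_smul_left, hx, mul_zero]

theorem IsRowSpan.finrank_eq {k n : ℕ} {A : Matrix (Fin k) (Fin n) ℝ}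
    {V : Submodule ℝ (EuclideanSpace ℝ (Fin n))} (h : IsRowSpan A V) :
    Module.finrank ℝ V = k := by
  have hl : LinearIndependent ℝ fun i => WithLp.toLp 2 (A i) :=
    h.1.map' (WithLp.linearEquiv 2 ℝ (Fin n → ℝ)).symm.toLinearMap (LinearEquiv.ker _)
  rw [← h.2, finrank_span_eq_card hl, Fintype.card_fin]

theorem IsRowSpan.le {k n : ℕ} {A : Matrix (Fin k) (Fin n) ℝ}
    {V : Submodule ℝ (EuclideanSpace ℝ (Fin n))} (h : IsRowSpan A V) : k ≤ n := by
  have := Submodule.finrank_le V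
  rwa [h.finrank_eq, finrank_euclideanSpace_fin] at this

theorem grPos_finrank {k n : ℕ} {V : Submodule ℝ (EuclideanSpace ℝ (Fin n))}
    (hV : V ∈ grPos k n) : Module.finrank ℝ V = k := by
  obtain ⟨A, hA, -⟩ := hV
  exact hA.finrank_eq

theorem grPos_le {k n : ℕ} {V : Submodule ℝ (EuclideanSpace ℝ (Fin n))}
    (hV : V ∈ grPos k n) : k ≤ n := by
  obtain ⟨A, hA, -⟩ := hV
  exact hA.le

theorem signVec_eq_zero_iff {n : ℕ} (w : EuclideanSpace ℝ (Fin n)) (i : Fin n) :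
    signVec w i = 0 ↔ w i = 0 := sign_eq_zero_iff

theorem signVec_ne_zero {n : ℕ} {w : EuclideanSpace ℝ (Fin n)} (hw : w ≠ 0) : signVec w ≠ 0 := by
  intro h
  apply hw
  ext i
  exact (signVec_eq_zero_iff w i).1 (congrFun h i)

theorem signVec_neg {n : ℕ} (w : EuclideanSpace ℝ (Fin n)) : signVec (-w) = -signVec w := by
  funext i
  simp [signVec, Left.sign_neg]

/-! ### Sign variation on totally positive subspaces -/

/-- The minor on any k columns is nonzero, so k coordinates determine a vector of V. -/
theorem eq_zero_of_mem_grPos {k n : ℕ} {V : Submodule ℝ (EuclideanSpace ℝ (Fin n))}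
    (hV : V ∈ grPos k n) {w : EuclideanSpace ℝ (Fin n)} (hw : w ∈ V) (S : Finset (Fin n))
    (hS : k ≤ S.card) (h : ∀ i ∈ S, w i = 0) : w = 0 := by
  obtain ⟨A, hA, hpos⟩ := hV
  obtain ⟨c, hc⟩ := (hA.mem_iff w).1 hw
  set I := S.orderEmbOfCardLe hS
  have : Matrix.vecMul c (A.submatrix id I) = 0 := by
    funext j
    have := congrFun hc (I j)
    rw [h (I j) (S.orderEmbOfCardLe_mem hS j)] at this
    simpa [Matrix.vecMul, dotProduct] using this
  have hc0 := Matrix.eq_zero_of_vecMul_eq_zero (hpos I).ne' this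
  rw [hc0, Matrix.zero_vecMul] at hc
  exact (WithLp.ofLp_injective 2 hc.symm)

/-- Put w on top of the matrix of V and restrict to the columns of f: the result is singular.
Expanding along the row w gives a sum of terms of one sign with positive minors as weights, so all k
+ 1 coordinates vanish. -/
theorem eq_zero_of_weakly_alternating {k n : ℕ} {V : Submodule ℝ (EuclideanSpace ℝ (Fin n))}
    (hV : V ∈ grPos k n) {w : EuclideanSpace ℝ (Fin n)} (hw : w ∈ V) (f : Fin (k + 1) ↪o Fin n)
    (a : ℝ) (ha : a ≠ 0) (h : ∀ j : Fin (k + 1), 0 ≤ (-1) ^ (j : ℕ) * w (f j) * a) : w = 0 := by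
  have hV' := hV
  obtain ⟨A, hA, hpos⟩ := hV
  obtain ⟨c, hc⟩ := (hA.mem_iff w).1 hw
  let M : Matrix (Fin (k + 1)) (Fin (k + 1)) ℝ :=
    Matrix.of (Fin.cons (fun j => w (f j)) fun i j => A i (f j))
  have hdet : M.det = 0 := by
    rw [← Matrix.exists_vecMul_eq_zero_iff]
    refine ⟨Fin.cons (-1) c, fun h0 => ?_, ?_⟩
    · simpa using congrFun h0 0
    · funext j
      have := congrFun hc (f j)
      simp only [Matrix.vecMul, dotProduct] at this
      simp [Matrix.vecMul, dotProduct, Fin.sum_univ_succ, M, this]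
  rw [Matrix.det_succ_row_zero] at hdet
  have hsub : ∀ j : Fin (k + 1), M.submatrix Fin.succ j.succAbove =
      A.submatrix id ((Fin.succAboveOrderEmb j).trans f) := by
    intro j
    ext x y
    simp [M]
  simp only [hsub] at hdet
  have hM : ∀ j, M 0 j = w (f j) := fun j => rfl
  simp only [hM] at hdet
  have hz : ∀ j, w (f j) = 0 := by
    have h1 : ∑ j : Fin (k + 1), (-1) ^ (j : ℕ) * w (f j) * a *
        (A.submatrix id ((Fin.succAboveOrderEmb j).trans f)).det = 0 := by
      rw [← mul_zero a, ← hdet, Finset.mul_sum]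
      exact Finset.sum_congr rfl fun j _ => by ring
    rw [Finset.sum_eq_zero_iff_of_nonneg
      (fun j _ => mul_nonneg (h j) (hpos _).le)] at h1
    intro j
    have := h1 j (Finset.mem_univ _)
    rw [mul_eq_zero, or_iff_left (hpos _).ne', mul_eq_zero, or_iff_left ha, mul_eq_zero,
      or_iff_right (pow_ne_zero _ (by norm_num))] at this
    exact this
  refine eq_zero_of_mem_grPos hV' hw (Finset.univ.map f.toEmbedding) (by simp) ?_
  simpa using hz

theorem SignType.cast_ne_zero {a : SignType} (ha : a ≠ 0) : (a : ℝ) ≠ 0 := by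
  revert ha
  cases a <;> simp

theorem SignType.nonneg_of_sign {x : ℝ} {s : SignType} (h : SignType.sign x ≠ 0 →
    s = SignType.sign x) : 0 ≤ x * (s : ℝ) := by
  rcases lt_trichotomy x 0 with hx | rfl | hx
  · rw [h (by simp [hx.ne]), sign_neg hx]; simp [hx.le]
  · simp
  · rw [h (by simp [hx.ne']), sign_pos hx]; simp [hx.le]

theorem varBar_lt_of_mem_grPos {k n : ℕ} {V : Submodule ℝ (EuclideanSpace ℝ (Fin n))}
    (hV : V ∈ grPos k n) {w : EuclideanSpace ℝ (Fin n)} (hw : w ∈ V) (hw0 : w ≠ 0) :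
    varBar (signVec w) < k := by
  classical
  refine (Finset.sup'_lt_iff _).2 fun τ hτ => ?_
  simp only [Finset.mem_filter, Finset.mem_univ, true_and] at hτ
  by_contra! hc
  -- The convention that `var 0` is -1 excludes the zero vector even for k = 0.
  have hτ0 : τ ≠ 0 := by
    rintro rfl
    simp [var] at hc
    omega
  rw [var_eq_signChanges hτ0, Nat.cast_le] at hc
  obtain ⟨f, a, ha, hf⟩ := exists_alternating τ hτ0 hc
  refine hw0 (eq_zero_of_weakly_alternating hV hw f a (SignType.cast_ne_zero ha) fun j => ?_)
  have := SignType.nonneg_of_sign (x := w (f j)) (s := τ (f j)) (fun h => hτ _ h)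
  rw [hf j] at this
  push_cast at this
  convert this using 1
  simp
  ring

/-- By dimension V has a nonzero vector supported on the m + 1 positions of Q. Its `varBar` is below
k, so by duality its alternated sign vector has m + 1 alternating positions, which must be all of Q.
-/
theorem exists_mem_grPos_alternating {k n m : ℕ} {V : Submodule ℝ (EuclideanSpace ℝ (Fin n))}
    (hV : V ∈ grPos k n) (hm : m + k = n) (Q : Fin (m + 1) ↪o Fin n) {a : SignType} (ha : a ≠ 0) :
    ∃ v ∈ V, (∀ i ∉ Set.range Q, v i = 0) ∧
      ∀ j, altSign (signVec v) (Q j) = (-1) ^ (j : ℕ) * a := by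
  classical
  have hmn : m + 1 ≤ n := by simpa using Fintype.card_le_of_embedding Q.toEmbedding
  obtain ⟨v, hv, hv0, hvQ⟩ : ∃ v ∈ V, v ≠ 0 ∧ ∀ i ∉ Set.range Q, v i = 0 := by
    let L : V →ₗ[ℝ] ({i // i ∉ Set.range Q} → ℝ) :=
      LinearMap.pi fun i => (EuclideanSpace.proj (𝕜 := ℝ) (i : Fin n)).toLinearMap ∘ₗ V.subtype
    have hL : LinearMap.ker L ≠ ⊥ := by
      apply LinearMap.ker_ne_bot_of_finrank_lt
      rw [grPos_finrank hV, Module.finrank_fintype_fun_eq_card]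
      have : Fintype.card {i // i ∉ Set.range Q} = n - (m + 1) := by
        have hc : Fintype.card (Set.range Q) = m + 1 := by
          rw [Set.card_range_of_injective Q.injective, Fintype.card_fin]
        rw [Fintype.card_subtype_compl, Fintype.card_fin]
        exact congrArg _ hc
      omega
    obtain ⟨v, hv, hv0⟩ := Submodule.exists_mem_ne_zero_of_ne_bot hL
    refine ⟨v, v.2, by simpa using hv0, fun i hi => congrFun (LinearMap.mem_ker.1 hv) ⟨i, hi⟩⟩
  have h1 := varBar_lt_of_mem_grPos hV hv hv0
  have hs := signVec_ne_zero hv0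
  rw [varBar_eq hs] at h1
  obtain ⟨f, b, hb, hf⟩ := exists_alternating (altSign (signVec v)) (altSign_ne_zero hs)
    (m := m) (by omega)
  have hfQ : Set.range f ⊆ Set.range Q := by
    rintro _ ⟨j, rfl⟩
    by_contra hc
    have h2 := hf j
    rw [altSign, (signVec_eq_zero_iff v _).2 (hvQ _ hc), mul_zero] at h2
    exact mul_ne_zero (pow_ne_zero _ (by decide)) hb h2.symm
  have hfQ' : (f : Fin (m + 1) → Fin n) = Q := by
    refine (StrictMono.range_inj f.strictMono Q.strictMono).1 ?_
    refine Set.eq_of_subset_of_card_le hfQ ?_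
    rw [Set.card_range_of_injective f.injective, Set.card_range_of_injective Q.injective]
  rw [hfQ'] at hf
  rcases SignType.eq_or_eq_neg hb ha with rfl | rfl
  · exact ⟨v, hv, hvQ, hf⟩
  · refine ⟨-v, V.neg_mem hv, fun i hi => by simp [hvQ i hi], fun j => ?_⟩
    rw [signVec_neg, altSign_neg, Pi.neg_apply, hf, mul_neg]

/-- If `varBar` were smaller, duality would give n - k + 1 positions alternating in the alternated
signs of w. A vector of V supported there with the same signs as w has positive inner product with
w. -/
theorem le_varBar_of_mem_orthogonal_grPos {k n : ℕ}
    {V : Submodule ℝ (EuclideanSpace ℝ (Fin n))} (hV : V ∈ grPos k n)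
    {w : EuclideanSpace ℝ (Fin n)} (hw : w ∈ Vᗮ) (hw0 : w ≠ 0) : k ≤ varBar (signVec w) := by
  by_contra! hc
  have hs := signVec_ne_zero hw0
  have hkn := grPos_le hV
  rw [varBar_eq hs] at hc
  obtain ⟨f, b, hb, hf⟩ := exists_alternating (altSign (signVec w)) (altSign_ne_zero hs)
    (m := n - k) (by omega)
  obtain ⟨v, hv, hv0, hvf⟩ := exists_mem_grPos_alternating hV (by omega) f hb
  have hsgn : ∀ j, signVec v (f j) = signVec w (f j) := by
    intro j
    rw [← altSign_altSign (signVec v), ← altSign_altSign (signVec w), altSign, hvf j, ← hf j]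
    rfl
  have hne : ∀ j, signVec w (f j) ≠ 0 := by
    intro j h2
    have h3 := hf j
    rw [altSign, h2, mul_zero] at h3
    exact mul_ne_zero (pow_ne_zero _ (by decide)) hb h3.symm
  have hmul : ∀ j, 0 < w (f j) * v (f j) := by
    intro j
    have h1 := hsgn j
    have h2 := hne j
    rw [← sign_eq_one_iff, sign_mul]
    change signVec w (f j) * signVec v (f j) = 1
    rw [h1]
    revert h2
    generalize signVec w (f j) = x
    revert x
    decide
  have h0 : inner ℝ v w = 0 := hw v hv
  rw [PiLp.inner_apply] at h0
  refine absurd h0 (ne_of_gt (Finset.sum_pos' (fun i _ => ?_) ⟨f 0, Finset.mem_univ _, ?_⟩))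
  · by_cases hi : i ∈ Set.range f
    · obtain ⟨j, rfl⟩ := hi
      simpa using (hmul j).le
    · simp [hv0 i hi]
  · simpa using hmul 0

end

section

open Filter Topology

/-! ### The Cauchy–Binet formula and total positivity -/

theorem det_mul_eq_sum {k n : ℕ} (A : Matrix (Fin k) (Fin n) ℝ) (G : Matrix (Fin n) (Fin k) ℝ) :
    (A * G).det = ∑ f : Fin k → Fin n, (∏ a, G (f a) a) * (A.submatrix id f).det := by
  have h : (A * G).transpose = fun a => ∑ i, G i a • A.transpose i := by
    funext a b
    simp [Matrix.mul_apply, Finset.sum_apply, mul_comm]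
  rw [← Matrix.det_transpose, h]
  have h2 := (Matrix.detRowAlternating (R := ℝ) (n := Fin k)).toMultilinearMap.map_sum
    (fun a (i : Fin n) => G i a • A.transpose i)
  refine h2.trans (Finset.sum_congr rfl fun f _ => ?_)
  rw [MultilinearMap.map_smul_univ, ← Matrix.det_transpose (A.submatrix id f), smul_eq_mul]
  rfl

/-- The Cauchy–Binet formula, as a sum over all maps instead of all subsets. -/
theorem factorial_mul_det_mul {k n : ℕ} (A : Matrix (Fin k) (Fin n) ℝ)
    (G : Matrix (Fin n) (Fin k) ℝ) :
    (k.factorial : ℝ) * (A * G).det =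
      ∑ f : Fin k → Fin n, (A.submatrix id f).det * (G.submatrix f id).det := by
  have h : ∀ π : Equiv.Perm (Fin k), (A * G).det = ∑ f : Fin k → Fin n,
      (A.submatrix id f).det * ((Equiv.Perm.sign π : ℤ) * ∏ a, G (f (π a)) a) := by
    intro π
    rw [det_mul_eq_sum, ← (Equiv.arrowCongr π.symm (Equiv.refl (Fin n))).sum_comp]
    refine Finset.sum_congr rfl fun f _ => ?_
    have : (A.submatrix id (f ∘ π)).det = (Equiv.Perm.sign π : ℤ) * (A.submatrix id f).det := by
      rw [← Matrix.det_permute' π (A.submatrix id f)]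
      rfl
    change (∏ a, G (f (π a)) a) * (A.submatrix id (f ∘ π)).det = _
    rw [this]
    ring
  have hc : (k.factorial : ℝ) * (A * G).det = ∑ _π : Equiv.Perm (Fin k), (A * G).det := by
    simp [Fintype.card_perm]
  rw [hc, Finset.sum_congr rfl fun π _ => h π, Finset.sum_comm]
  refine Finset.sum_congr rfl fun f _ => ?_
  rw [← Finset.mul_sum, Matrix.det_apply' (G.submatrix f id)]
  rfl

/-- Sorting the indices multiplies corresponding minors of A and G by the same sign, so the products
in the Cauchy–Binet sum only depend on the set of indices. -/
theorem exists_orderEmb_det {k n : ℕ} (f : Fin k → Fin n) (hf : Function.Injective f) :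
    ∃ (I : Fin k ↪o Fin n) (ε : ℝ), ε * ε = 1 ∧
      (∀ A : Matrix (Fin k) (Fin n) ℝ,
        (A.submatrix id f).det = ε * (A.submatrix id I).det) ∧
      ∀ G : Matrix (Fin n) (Fin k) ℝ, (G.submatrix f id).det = ε * (G.submatrix I id).det := by
  set π := Tuple.sort f with hπ
  have hm : StrictMono (f ∘ π) :=
    (Tuple.monotone_sort f).strictMono_of_injective (hf.comp π.injective)
  have hε : ((Equiv.Perm.sign π : ℤ) : ℝ) * (Equiv.Perm.sign π : ℤ) = 1 := by
    rcases Int.units_eq_one_or (Equiv.Perm.sign π) with h | h <;> rw [h] <;> simp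
  refine ⟨OrderEmbedding.ofStrictMono _ hm, (Equiv.Perm.sign π : ℤ), hε, fun A => ?_, fun G => ?_⟩
  · have : (A.submatrix id (f ∘ π)).det = (Equiv.Perm.sign π : ℤ) * (A.submatrix id f).det := by
      rw [← Matrix.det_permute' π (A.submatrix id f)]; rfl
    change _ = _ * (A.submatrix id (f ∘ π)).det
    rw [this, ← mul_assoc, hε, one_mul]
  · have : (G.submatrix (f ∘ π) id).det = (Equiv.Perm.sign π : ℤ) * (G.submatrix f id).det := by
      rw [← Matrix.det_permute π (G.submatrix f id)]; rfl
    change _ = _ * (G.submatrix (f ∘ π) id).det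
    rw [this, ← mul_assoc, hε, one_mul]

theorem det_submatrix_eq_zero_of_not_injective {k n : ℕ} (A : Matrix (Fin k) (Fin n) ℝ)
    {f : Fin k → Fin n} (hf : ¬ Function.Injective f) : (A.submatrix id f).det = 0 := by
  simp only [Function.Injective, not_forall] at hf
  obtain ⟨i, j, h, hij⟩ := hf
  exact Matrix.det_zero_of_column_eq hij fun a => by simp [h]

/-- In the Cauchy–Binet sum all terms are nonnegative, and one is positive because A has a nonzero
maximal minor. -/
theorem det_mul_pos {k n : ℕ} {A : Matrix (Fin k) (Fin n) ℝ} (hA : LinearIndependent ℝ A.row)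
    (hpos : ∀ I : Fin k ↪o Fin n, 0 ≤ (A.submatrix id I).det) {G : Matrix (Fin n) (Fin k) ℝ}
    (hG : ∀ I : Fin k ↪o Fin n, 0 < (G.submatrix I id).det) : 0 < (A * G).det := by
  -- The Gram determinant is nonzero by independence of the rows; Cauchy–Binet applied to it then
  -- yields a nonzero minor of A.
  have hdet : (A * A.transpose).det ≠ 0 := by
    intro h0
    obtain ⟨v, hv, h⟩ := Matrix.exists_vecMul_eq_zero_iff.2 h0
    have h1 : dotProduct (Matrix.vecMul v A) (Matrix.vecMul v A) = 0 := by
      rw [← Matrix.vecMul_vecMul] at h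
      have := congrArg (fun u => dotProduct u v) h
      simp only [zero_dotProduct] at this
      rwa [Matrix.vecMul_transpose, dotProduct_comm, Matrix.dotProduct_mulVec] at this
    have h2 := dotProduct_self_eq_zero.1 h1
    have h3 := Matrix.vecMul_injective_iff.2 hA
    exact hv (h3 (by simpa using h2))
  have hex : ∃ f : Fin k → Fin n, (A.submatrix id f).det ≠ 0 := by
    by_contra! hc
    have := factorial_mul_det_mul A A.transpose
    simp only [hc, zero_mul, Finset.sum_const_zero] at this
    exact mul_ne_zero (by exact_mod_cast k.factorial_ne_zero) hdet this
  have key : ∀ f : Fin k → Fin n, 0 ≤ (A.submatrix id f).det * (G.submatrix f id).det ∧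
      ((A.submatrix id f).det ≠ 0 → 0 < (A.submatrix id f).det * (G.submatrix f id).det) := by
    intro f
    by_cases hf : Function.Injective f
    · obtain ⟨I, ε, hε, h1, h2⟩ := exists_orderEmb_det f hf
      have h3 : (A.submatrix id f).det * (G.submatrix f id).det =
          (A.submatrix id I).det * (G.submatrix I id).det := by
        rw [h1, h2]
        linear_combination ((A.submatrix id I).det * (G.submatrix I id).det) * hε
      rw [h3, h1]
      exact ⟨mul_nonneg (hpos I) (hG I).le, fun h =>
        mul_pos ((hpos I).lt_of_ne' (right_ne_zero_of_mul h)) (hG I)⟩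
    · rw [det_submatrix_eq_zero_of_not_injective A hf]
      simp
  obtain ⟨f, hf⟩ := hex
  have h := factorial_mul_det_mul A G
  have hp : 0 < (k.factorial : ℝ) * (A * G).det := by
    rw [h]
    exact Finset.sum_pos' (fun f _ => (key f).1) ⟨f, Finset.mem_univ _, (key f).2 hf⟩
  exact pos_of_mul_pos_right hp (by positivity)

/-! ### A totally positive deformation of the identity -/

/-- The matrix with entries `t ^ ((i - j) ^ 2)`. -/
def gaussMatrix (n : ℕ) (t : ℝ) : Matrix (Fin n) (Fin n) ℝ :=
  fun i j => t ^ (((i : ℤ) - j) ^ 2).toNat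

theorem gaussMatrix_zero (n : ℕ) : gaussMatrix n 0 = 1 := by
  ext i j
  rw [gaussMatrix, Matrix.one_apply]
  split_ifs with h
  · simp [h]
  · refine zero_pow ?_
    have : (i : ℤ) - j ≠ 0 := by
      intro h2; apply h; ext; omega
    have : 0 < ((i : ℤ) - j) ^ 2 := by positivity
    omega

theorem continuous_gaussMatrix (n : ℕ) : Continuous (gaussMatrix n) :=
  continuous_matrix fun _ _ => continuous_pow _

/-- After cancelling squares this is the strict rearrangement inequality; the only monotone
permutation of `Fin k` is the identity. -/
theorem sum_sq_lt_sum_sq_perm {k n : ℕ} (I J : Fin k ↪o Fin n) {π : Equiv.Perm (Fin k)}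
    (hπ : π ≠ 1) : ∑ a, ((I a : ℤ) - J a) ^ 2 < ∑ a, ((I (π a) : ℤ) - J a) ^ 2 := by
  have h := (Monovary.sum_comp_perm_mul_lt_sum_mul_iff (σ := π) (f := fun a => (I a : ℤ))
    (g := fun a => (J a : ℤ)) ?_).2 ?_
  · have e : ∑ a, (I (π a) : ℤ) ^ 2 = ∑ a, (I a : ℤ) ^ 2 :=
      Equiv.sum_comp π fun a => (I a : ℤ) ^ 2
    simp only [sub_sq, Finset.sum_add_distrib, Finset.sum_sub_distrib, e, mul_assoc,
      ← Finset.mul_sum]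
    linarith
  · intro a b hab
    have h1 : ((J a : ℕ) : ℤ) < (J b : ℕ) := hab
    have h2 : a < b := J.lt_iff_lt.1 (Fin.lt_def.2 (by exact_mod_cast h1))
    have h3 : (I a : ℕ) ≤ I b := Fin.le_def.1 (I.monotone h2.le)
    exact Int.ofNat_le.2 h3
  · intro hm
    apply hπ
    have hmono : StrictMono π := by
      refine Monotone.strictMono_of_injective (fun a b hab => ?_) π.injective
      rcases hab.eq_or_lt with rfl | hab
      · rfl
      · have h1 : (J a : ℕ) < J b := Fin.lt_def.1 (J.strictMono hab)
        have h2 : ((I (π a) : ℕ) : ℤ) ≤ (I (π b) : ℕ) := hm (Int.ofNat_lt.2 h1)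
        exact I.le_iff_le.1 (Fin.le_def.2 (by exact_mod_cast h2))
    have : (π : Fin k → Fin k) = id :=
      (StrictMono.range_inj hmono strictMono_id).1 (by simp [π.surjective.range_eq])
    exact Equiv.ext fun a => congrFun this a

/-- In the Leibniz expansion the identity alone contributes the lowest power of t, with coefficient
1, and this term dominates near 0. -/
theorem eventually_gaussMatrix_minor_pos {k n : ℕ} (I J : Fin k ↪o Fin n) :
    ∀ᶠ t in 𝓝[>] (0 : ℝ), 0 < ((gaussMatrix n t).submatrix I J).det := by
  let e : Equiv.Perm (Fin k) → ℕ := fun π => ∑ a, (((I (π a) : ℤ) - J a) ^ 2).toNat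
  have he : ∀ π, (e π : ℤ) = ∑ a, ((I (π a) : ℤ) - J a) ^ 2 := by
    intro π
    simp only [e, Nat.cast_sum]
    exact Finset.sum_congr rfl fun a _ => Int.toNat_of_nonneg (sq_nonneg _)
  have hlt : ∀ π, π ≠ 1 → e 1 < e π := by
    intro π hπ
    have := sum_sq_lt_sum_sq_perm I J hπ
    rw [← he π] at this
    have h1 := he 1
    simp only [Equiv.Perm.coe_one, id_eq] at h1
    rw [← h1] at this
    exact_mod_cast this
  let F : ℝ → ℝ := fun t => ∑ π : Equiv.Perm (Fin k), ((Equiv.Perm.sign π : ℤ) : ℝ) *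
    t ^ (e π - e 1)
  have hF : Continuous F := by fun_prop
  have hF0 : F 0 = 1 := by
    simp only [F]
    rw [Finset.sum_eq_single 1]
    · simp
    · intro π _ hπ
      rw [zero_pow (Nat.sub_ne_zero_of_lt (hlt π hπ)), mul_zero]
    · simp
  have hdet : ∀ t, ((gaussMatrix n t).submatrix I J).det = t ^ e 1 * F t := by
    intro t
    rw [Matrix.det_apply', Finset.mul_sum]
    refine Finset.sum_congr rfl fun π _ => ?_
    have h1 : e 1 ≤ e π := by
      by_cases h : π = 1
      · rw [h]
      · exact (hlt π h).le
    rw [mul_left_comm, ← pow_add, Nat.add_sub_cancel' h1]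
    simp [gaussMatrix, Finset.prod_pow_eq_pow_sum, e]
  have hev : ∀ᶠ t in 𝓝 (0 : ℝ), 0 < F t :=
    hF.continuousAt.eventually (lt_mem_nhds (by rw [hF0]; exact one_pos))
  filter_upwards [nhdsWithin_le_nhds hev, self_mem_nhdsWithin] with t h1 h2
  rw [hdet]
  exact mul_pos (pow_pos h2 _) h1

theorem isRowSpan_of_minors_pos {k n : ℕ} (hkn : k ≤ n) {B : Matrix (Fin k) (Fin n) ℝ}
    (hB : ∀ I : Fin k ↪o Fin n, 0 < (B.submatrix id I).det) :
    IsRowSpan B (Submodule.span ℝ (Set.range fun i => WithLp.toLp 2 (B i))) := by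
  refine ⟨Matrix.vecMul_injective_iff.1 ?_, rfl⟩
  rw [← Matrix.coe_vecMulLinear, ← LinearMap.ker_eq_bot, LinearMap.ker_eq_bot']
  intro v hv
  refine Matrix.eq_zero_of_vecMul_eq_zero (hB (Fin.castLEOrderEmb hkn)).ne' ?_
  funext j
  simpa [Matrix.vecMul, dotProduct] using congrFun hv (Fin.castLE hkn j)

/-- For small t > 0 the rows of A times the Gaussian matrix G span a totally positive subspace. A
vector orthogonal to it and close to w keeps the nonzero signs of w, so its `varBar` is at most that
of w. -/
theorem le_varBar_of_mem_orthogonal_grNonneg {k n : ℕ}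
    {V : Submodule ℝ (EuclideanSpace ℝ (Fin n))} (hV : V ∈ grNonneg k n)
    {w : EuclideanSpace ℝ (Fin n)} (hw : w ∈ Vᗮ) (hw0 : w ≠ 0) : k ≤ varBar (signVec w) := by
  obtain ⟨A, hA, hpos⟩ := hV
  have hAw := (hA.mem_orthogonal_iff w).1 hw
  -- Since A G adj(G) w = det(G) A w = 0, this vector stays orthogonal. The adjugate replaces the
  -- inverse: it is continuous in t without invertibility and is the identity at t = 0.
  let u : ℝ → EuclideanSpace ℝ (Fin n) := fun t =>
    WithLp.toLp 2 (Matrix.mulVec (gaussMatrix n t).adjugate (WithLp.ofLp w))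
  have hu : ∀ i, Continuous fun t => u t i := by
    intro i
    have : Continuous fun t => Matrix.mulVec (gaussMatrix n t).adjugate (WithLp.ofLp w) :=
      (continuous_gaussMatrix n).matrix_adjugate.matrix_mulVec continuous_const
    exact (continuous_apply i).comp this
  have hu0 : u 0 = w := by
    simp [u, gaussMatrix_zero]
  have h1 : ∀ᶠ t in 𝓝[>] (0 : ℝ), ∀ I J : Fin k ↪o Fin n,
      0 < ((gaussMatrix n t).submatrix I J).det := by
    simp only [eventually_all]
    exact fun I J => eventually_gaussMatrix_minor_pos I J
  have h2 : ∀ᶠ t in 𝓝[>] (0 : ℝ), ∀ i, signVec w i ≠ 0 → signVec (u t) i = signVec w i := by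
    rw [eventually_all]
    intro i
    refine nhdsWithin_le_nhds ?_
    have hc : Tendsto (fun t => u t i) (𝓝 0) (𝓝 (w i)) := by
      have := (hu i).tendsto 0
      rwa [hu0] at this
    rcases lt_trichotomy (w i) 0 with h | h | h
    · filter_upwards [hc.eventually (gt_mem_nhds h)] with t ht _
      simp [signVec, sign_neg ht, sign_neg h]
    · filter_upwards with t ht
      exact absurd ((signVec_eq_zero_iff w i).2 h) ht
    · filter_upwards [hc.eventually (lt_mem_nhds h)] with t ht _
      simp [signVec, sign_pos ht, sign_pos h]
  obtain ⟨t, ht1, ht2⟩ := (h1.and h2).exists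
  have hB : ∀ I : Fin k ↪o Fin n, 0 < ((A * gaussMatrix n t).submatrix id I).det := by
    intro I
    have : (A * gaussMatrix n t).submatrix id I = A * (gaussMatrix n t).submatrix id I := by
      ext; simp [Matrix.mul_apply]
    rw [this]
    exact det_mul_pos hA.1 hpos fun J => ht1 J I
  have hspan := isRowSpan_of_minors_pos hA.le hB
  have hut : u t ≠ 0 := by
    intro h0
    obtain ⟨i, hi⟩ := Function.ne_iff.1 (signVec_ne_zero hw0)
    apply hi
    rw [← ht2 i hi, h0]
    simp [signVec]
  refine (le_varBar_of_mem_orthogonal_grPos ⟨_, hspan, hB⟩ (w := u t) ?_ hut).trans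
    (Refines.varBar_le ht2)
  rw [hspan.mem_orthogonal_iff]
  simp only [u]
  rw [← Matrix.mulVec_mulVec, Matrix.mulVec_mulVec (WithLp.ofLp w), Matrix.mul_adjugate,
    Matrix.smul_mulVec, Matrix.one_mulVec, Matrix.mulVec_smul, hAw, smul_zero]

end

/-! ### Perturbation and interpolation in totally positive subspaces -/

section

open Filter Topology

theorem varBar_neg {n : ℕ} {σ : Fin n → SignType} (hσ : σ ≠ 0) : varBar (-σ) = varBar σ := by
  have hσ' : -σ ≠ 0 := fun h => hσ (by
    funext i
    have := congrFun h i
    simpa using this)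
  have h := signChanges_neg n 0 (altSign σ)
  rw [neg_zero] at h
  rw [varBar_eq hσ, varBar_eq hσ', altSign_neg, h]

theorem exists_signVec_add_smul {n : ℕ} (w u : EuclideanSpace ℝ (Fin n)) :
    ∃ ε : ℝ, 0 < ε ∧ ∀ i, signVec (w + ε • u) i = if w i = 0 then signVec u i
      else signVec w i := by
  have h : ∀ᶠ ε in 𝓝[>] (0 : ℝ), ∀ i, signVec (w + ε • u) i = if w i = 0 then signVec u i
      else signVec w i := by
    rw [eventually_all]
    intro i
    have hc : Tendsto (fun ε : ℝ => w i + ε * u i) (𝓝 0) (𝓝 (w i)) := by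
      have : Continuous fun ε : ℝ => w i + ε * u i := by fun_prop
      simpa using this.tendsto 0
    have hv : ∀ ε : ℝ, signVec (w + ε • u) i = SignType.sign (w i + ε * u i) := fun ε => by
      simp [signVec]
    rcases lt_trichotomy (w i) 0 with h | h | h
    · filter_upwards [nhdsWithin_le_nhds (hc.eventually (gt_mem_nhds h))] with t ht
      rw [hv, sign_neg ht, if_neg h.ne, signVec, sign_neg h]
    · filter_upwards [self_mem_nhdsWithin] with t ht
      rw [hv, if_pos h, h, zero_add, sign_mul, sign_pos ht, one_mul, signVec]
    · filter_upwards [nhdsWithin_le_nhds (hc.eventually (lt_mem_nhds h))] with t ht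
      rw [hv, sign_pos ht, if_neg h.ne', signVec, sign_pos h]
  obtain ⟨ε, h1, h2⟩ := (h.and self_mem_nhdsWithin).exists
  exact ⟨ε, h2, h1⟩

theorem exists_mem_grPos_eq {k n : ℕ} {V : Submodule ℝ (EuclideanSpace ℝ (Fin n))}
    (hV : V ∈ grPos k n) (S : Finset (Fin n)) (hS : S.card ≤ k) (y : Fin n → ℝ) :
    ∃ v ∈ V, ∀ i ∈ S, v i = y i := by
  obtain ⟨T, hST, -, hT⟩ := Finset.exists_subsuperset_card_eq (Finset.subset_univ S) hS
    (by simpa using grPos_le hV)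
  let L : V →ₗ[ℝ] (T → ℝ) :=
    LinearMap.pi fun i => (EuclideanSpace.proj (𝕜 := ℝ) (i : Fin n)).toLinearMap ∘ₗ V.subtype
  have hinj : Function.Injective L := by
    rw [← LinearMap.ker_eq_bot, LinearMap.ker_eq_bot']
    intro v hv
    exact Subtype.ext (eq_zero_of_mem_grPos hV v.2 T hT.ge fun i hi => congrFun hv ⟨i, hi⟩)
  have hsurj : Function.Surjective L := by
    rwa [← LinearMap.injective_iff_surjective_of_finrank_eq_finrank]
    rw [grPos_finrank hV, Module.finrank_fintype_fun_eq_card, Fintype.card_coe, hT]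
  obtain ⟨v, hv⟩ := hsurj fun i => y i
  exact ⟨v, v.2, fun i hi => congrFun hv ⟨i, hST hi⟩⟩

/-! ### The amplituhedron consists of lines -/

theorem varBar_eq_of_mem_inf {n k : ℕ} {V W : Submodule ℝ (EuclideanSpace ℝ (Fin n))}
    (hV : V ∈ grNonneg k n) (hW : W ∈ grPos (k + 1) n) {w : EuclideanSpace ℝ (Fin n)}
    (hw : w ∈ Vᗮ ⊓ W) (hw0 : w ≠ 0) : varBar (signVec w) = k := by
  have h1 := le_varBar_of_mem_orthogonal_grNonneg hV hw.1 hw0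
  have h2 := varBar_lt_of_mem_grPos hW hw.2 hw0
  push_cast at h2
  omega

/-- Let i be the first coordinate that is not identically zero on the intersection. If a nonzero x
vanished at i, a perturbation could give it a new leading sign and lower its `varBar` below k. So
coordinate i is injective on the intersection. -/
theorem inf_eq_span_singleton {n k : ℕ} {V W : Submodule ℝ (EuclideanSpace ℝ (Fin n))}
    (hV : V ∈ grNonneg k n) (hW : W ∈ grPos (k + 1) n) {w : EuclideanSpace ℝ (Fin n)}
    (hw : w ∈ Vᗮ ⊓ W) (hw0 : w ≠ 0) : Vᗮ ⊓ W = Submodule.span ℝ {w} := by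
  set U := Vᗮ ⊓ W with hU
  have hne : {i : Fin n | ∃ u ∈ U, u i ≠ 0}.Nonempty := by
    by_contra hc
    rw [Set.not_nonempty_iff_eq_empty, Set.eq_empty_iff_forall_notMem] at hc
    apply hw0
    ext i
    by_contra h
    exact hc i ⟨w, hw, h⟩
  obtain ⟨i, ⟨p, hp, hpi⟩, hmin⟩ :
      ∃ i, (∃ u ∈ U, u i ≠ 0) ∧ ∀ j < i, ∀ u ∈ U, u j = 0 := by
    refine ⟨wellFounded_lt.min _ hne, wellFounded_lt.min_mem _ hne, fun j hj u hu => ?_⟩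
    by_contra h
    have hj' : j ∈ {i : Fin n | ∃ u ∈ U, u i ≠ 0} := ⟨u, hu, h⟩
    exact wellFounded_lt.not_lt_min _ hj' hj
  have key : ∀ x ∈ U, x i = 0 → x = 0 := by
    intro x hx hxi
    by_contra hx0
    have hs := signVec_ne_zero hx0
    obtain ⟨b, hb, -, hb2⟩ := exists_lead _ (altSign_ne_zero hs)
    -- The sign at i is chosen opposite to the leading sign b of the alternated x, which costs one
    -- extra change and, by duality, one unit of `varBar`.
    obtain ⟨u, hu, hui⟩ : ∃ u ∈ U, altSign (signVec u) i = -b := by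
      have h1 : altSign (signVec p) i ≠ 0 :=
        mul_ne_zero (pow_ne_zero _ (by decide)) ((signVec_eq_zero_iff p i).not.2 hpi)
      rcases SignType.eq_or_eq_neg hb h1 with h | h
      · refine ⟨-p, U.neg_mem hp, ?_⟩
        rw [signVec_neg, altSign_neg, Pi.neg_apply, h]
      · exact ⟨p, hp, h⟩
    obtain ⟨ε, hε, hsgn⟩ := exists_signVec_add_smul x u
    have hy : x + ε • u ∈ U := U.add_mem hx (U.smul_mem _ hu)
    have href : Refines (signVec (x + ε • u)) (signVec x) := by
      intro j hj
      rw [hsgn, if_neg ((signVec_eq_zero_iff x j).not.1 hj)]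
    have hyi : altSign (signVec (x + ε • u)) i = -b := by
      rw [← hui, altSign, hsgn, if_pos hxi]; rfl
    have h := signChanges_lt_of_lead href.altSign i (fun j hj => ?_) hyi hb2 ?_
    · have hy0 : x + ε • u ≠ 0 := by
        intro h0
        rw [h0] at hyi
        simp [altSign, signVec] at hyi
        exact hb (by simpa using hyi.symm)
      have e1 := varBar_eq_of_mem_inf hV hW hx hx0
      have e2 := varBar_eq_of_mem_inf hV hW hy hy0
      rw [varBar_eq hs] at e1
      rw [varBar_eq (signVec_ne_zero hy0)] at e2
      omega
    · rw [altSign, (signVec_eq_zero_iff _ j).2 (hmin j hj _ hy), mul_zero]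
    · rw [altSign, (signVec_eq_zero_iff _ i).2 hxi, mul_zero]
  have hspan : ∀ u ∈ U, u = (u i / p i) • p := by
    intro u hu
    rw [← sub_eq_zero]
    refine key _ (U.sub_mem hu (U.smul_mem _ hp)) ?_
    simp [hpi]
  have hwi : w i ≠ 0 := fun h => hw0 (key w hw h)
  apply le_antisymm
  · intro u hu
    rw [Submodule.mem_span_singleton]
    refine ⟨u i / w i, ?_⟩
    rw [eq_comm, ← sub_eq_zero]
    refine key _ (U.sub_mem hu (U.smul_mem _ hw)) ?_
    simp [hwi]
  · rw [Submodule.span_singleton_le_iff_mem]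
    exact hw

theorem exists_mem_inf_ne_zero {n k : ℕ} {V W : Submodule ℝ (EuclideanSpace ℝ (Fin n))}
    (hV : V ∈ grNonneg k n) (hW : W ∈ grPos (k + 1) n) : ∃ w ∈ Vᗮ ⊓ W, w ≠ 0 := by
  obtain ⟨A, hA, -⟩ := hV
  let L : W →ₗ[ℝ] (Fin k → ℝ) :=
    A.mulVecLin ∘ₗ (WithLp.linearEquiv 2 ℝ (Fin n → ℝ)).toLinearMap ∘ₗ W.subtype
  have hL : LinearMap.ker L ≠ ⊥ := by
    apply LinearMap.ker_ne_bot_of_finrank_lt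
    rw [grPos_finrank hW, Module.finrank_fintype_fun_eq_card, Fintype.card_fin]
    omega
  obtain ⟨v, hv, hv0⟩ := Submodule.exists_mem_ne_zero_of_ne_bot hL
  exact ⟨v, ⟨(hA.mem_orthogonal_iff v).2 hv, v.2⟩, by simpa using hv0⟩

/-! ### Realizing lines of `W` by totally nonnegative subspaces -/

/-- The rows of A span the hyperplane orthogonal to x. Its maximal minors, with alternating signs,
again form a vector in the kernel of A, hence are proportional to x; weak alternation of x makes the
minors themselves nonnegative. -/
theorem exists_hyperplane_matrix {k : ℕ} {x : Fin (k + 1) → ℝ} {a : ℝ}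
    (h : ∀ j : Fin (k + 1), 0 ≤ (-1) ^ (j : ℕ) * x j * a) {c₀ : Fin (k + 1)} (hc₀ : x c₀ ≠ 0)
    (ha : a ≠ 0) :
    ∃ A : Matrix (Fin k) (Fin (k + 1)) ℝ, A.mulVec x = 0 ∧
      (A.submatrix id c₀.succAbove).det = 1 ∧
      ∀ c : Fin (k + 1), 0 ≤ (A.submatrix id c.succAbove).det := by
  let A : Matrix (Fin k) (Fin (k + 1)) ℝ := fun r c =>
    if c = c₀ then -(x (c₀.succAbove r) / x c₀) else if c = c₀.succAbove r then 1 else 0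
  have hmul : ∀ v : Fin (k + 1) → ℝ, ∀ r,
      A.mulVec v r = v (c₀.succAbove r) - x (c₀.succAbove r) / x c₀ * v c₀ := by
    intro v r
    rw [Matrix.mulVec, dotProduct, Fin.sum_univ_succAbove _ c₀]
    simp [A, Fin.succAbove_ne]
    ring
  have hone : (A.submatrix id c₀.succAbove).det = 1 := by
    have : A.submatrix id c₀.succAbove = 1 := by
      ext r c
      rw [Matrix.submatrix_apply, Matrix.one_apply]
      simp only [A, Fin.succAbove_ne, if_false, id, Fin.succAbove_right_inj]
      simp only [eq_comm]
    rw [this, Matrix.det_one]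
  refine ⟨A, ?_, hone, ?_⟩
  · funext r
    rw [hmul]
    field_simp
    simp
  -- Repeating row r on top of A gives a vanishing determinant; this is its expansion along that
  -- row.
  have hy : ∀ r, ∑ c : Fin (k + 1),
      A r c * ((-1) ^ (c : ℕ) * (A.submatrix id c.succAbove).det) = 0 := by
    intro r
    let M : Matrix (Fin (k + 1)) (Fin (k + 1)) ℝ := Matrix.of (Fin.cons (A r) A)
    have hM : M.det = 0 := Matrix.det_zero_of_row_eq (Fin.succ_ne_zero r).symm (by
      funext c; rfl)
    rw [Matrix.det_succ_row_zero] at hM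
    rw [← hM]
    refine Finset.sum_congr rfl fun c _ => ?_
    have : M.submatrix Fin.succ c.succAbove = A.submatrix id c.succAbove := by
      ext; rfl
    rw [this]
    change _ = (-1) ^ (c : ℕ) * A r c * _
    ring
  have hΔ : ∀ c : Fin (k + 1), (-1) ^ (c : ℕ) * (A.submatrix id c.succAbove).det =
      x c / x c₀ * (-1) ^ (c₀ : ℕ) := by
    intro c
    rcases Fin.eq_self_or_eq_succAbove c₀ c with rfl | ⟨r, rfl⟩
    · rw [hone]; field_simp
    · have h1 := hmul (fun c => (-1) ^ (c : ℕ) * (A.submatrix id c.succAbove).det) r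
      rw [Matrix.mulVec, dotProduct, hy r] at h1
      rw [hone, mul_one] at h1
      linarith
  intro c
  have hsq : ∀ j : ℕ, ((-1 : ℝ) ^ j) * (-1) ^ j = 1 := fun j => by
    rw [← mul_pow]; simp
  have h1 : (A.submatrix id c.succAbove).det =
      ((-1) ^ (c : ℕ) * x c * a) * ((-1) ^ (c₀ : ℕ) * x c₀ * a) / (x c₀ * a) ^ 2 := by
    have h2 : (A.submatrix id c.succAbove).det =
        (-1) ^ (c : ℕ) * (x c / x c₀ * (-1) ^ (c₀ : ℕ)) := by
      rw [← hΔ, ← mul_assoc, hsq, one_mul]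
    rw [h2]
    field_simp
  rw [h1]
  exact div_nonneg (mul_nonneg (h c) (h c₀)) (sq_nonneg _)

theorem exists_succAbove_of_strictMono {k : ℕ} {g : Fin k → Fin (k + 1)} (hg : StrictMono g) :
    ∃ c : Fin (k + 1), g = c.succAbove := by
  have hns : ¬ Function.Surjective g := by
    intro hs
    have := Fintype.card_le_of_surjective g hs
    simp at this
  simp only [Function.Surjective, not_forall, not_exists] at hns
  obtain ⟨c, hc⟩ := hns
  refine ⟨c, (StrictMono.range_inj hg (Fin.strictMono_succAbove c)).1 ?_⟩
  refine Set.eq_of_subset_of_card_le ?_ ?_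
  · rw [Fin.range_succAbove]
    rintro _ ⟨j, rfl⟩
    exact hc j
  · rw [Set.card_range_of_injective hg.injective,
      Set.card_range_of_injective Fin.succAbove_right_injective]

/-- A filling of the signs of w with k changes provides k + 1 columns on which w alternates weakly.
The hyperplane matrix of w on these columns, extended by zero columns, spans V. -/
theorem exists_grNonneg_orthogonal {n k : ℕ} {W : Submodule ℝ (EuclideanSpace ℝ (Fin n))}
    (hW : W ∈ grPos (k + 1) n) {w : EuclideanSpace ℝ (Fin n)} (hw : w ∈ W) (hw0 : w ≠ 0)
    (hk : varBar (signVec w) = k) : ∃ V ∈ grNonneg k n, w ∈ Vᗮ := by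
  classical
  obtain ⟨τ, hτ, hvar⟩ := Finset.exists_mem_eq_sup' (s := Finset.univ.filter
    fun τ : Fin n → SignType => ∀ i, signVec w i ≠ 0 → τ i = signVec w i)
    ⟨signVec w, by simp⟩ var
  simp only [Finset.mem_filter, Finset.mem_univ, true_and] at hτ
  have hvar' : (k : ℤ) = var τ := by rw [← hk, ← hvar]; rw [varBar]
  have hτ0 : τ ≠ 0 := by
    rintro rfl
    simp [var] at hvar'
  rw [var_eq_signChanges hτ0, Nat.cast_inj] at hvar'
  obtain ⟨f, a, ha, hf⟩ := exists_alternating τ hτ0 hvar'.le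
  have halt : ∀ j : Fin (k + 1), 0 ≤ (-1) ^ (j : ℕ) * w (f j) * (a : ℝ) := by
    intro j
    have := SignType.nonneg_of_sign (x := w (f j)) (s := τ (f j)) (fun h => hτ _ h)
    rw [hf j] at this
    push_cast at this
    convert this using 1
    simp
    ring
  obtain ⟨c₀, hc₀⟩ : ∃ c₀, w (f c₀) ≠ 0 := by
    by_contra! hc
    exact hw0 (eq_zero_of_mem_grPos hW hw (Finset.univ.map f.toEmbedding) (by simp)
      (by simpa using hc))
  obtain ⟨A, hAx, hA1, hA⟩ := exists_hyperplane_matrix halt hc₀ (SignType.cast_ne_zero ha)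
  let B : Matrix (Fin k) (Fin n) ℝ := fun r i => ∑ c, if f c = i then A r c else 0
  have hBf : ∀ r c, B r (f c) = A r c := by
    intro r c
    simp [B]
  have hB0 : ∀ r, ∀ i ∉ Set.range f, B r i = 0 := by
    intro r i hi
    exact Finset.sum_eq_zero fun c _ => if_neg fun h => hi ⟨c, h⟩
  have hBsub : ∀ c : Fin (k + 1), B.submatrix id (f ∘ c.succAbove) =
      A.submatrix id c.succAbove := by
    intro c
    ext r j
    exact hBf r _
  have hspan : IsRowSpan B (Submodule.span ℝ (Set.range fun i => WithLp.toLp 2 (B i))) := by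
    refine ⟨Matrix.vecMul_injective_iff.1 ?_, rfl⟩
    rw [← Matrix.coe_vecMulLinear, ← LinearMap.ker_eq_bot, LinearMap.ker_eq_bot']
    intro v hv
    refine Matrix.eq_zero_of_vecMul_eq_zero (M := B.submatrix id (f ∘ c₀.succAbove)) ?_ ?_
    · rw [hBsub, hA1]; exact one_ne_zero
    · funext j
      simpa [Matrix.vecMul, dotProduct] using congrFun hv (f (c₀.succAbove j))
  refine ⟨_, ⟨B, hspan, fun I => ?_⟩, ?_⟩
  · by_cases hI : ∀ j, I j ∈ Set.range f
    · choose g hg using hI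
      have hmono : StrictMono g := by
        intro i j hij
        rw [← f.lt_iff_lt, hg, hg]
        exact I.strictMono hij
      obtain ⟨c, rfl⟩ := exists_succAbove_of_strictMono hmono
      have : (I : Fin k → Fin n) = f ∘ c.succAbove := funext fun j => (hg j).symm
      rw [this, hBsub]
      exact hA c
    · push Not at hI
      obtain ⟨j, hj⟩ := hI
      rw [Matrix.det_eq_zero_of_column_eq_zero j fun r => hB0 r _ hj]
  · rw [hspan.mem_orthogonal_iff]
    funext r
    rw [← hAx]
    simp only [Matrix.mulVec, dotProduct, B, Finset.sum_mul]
    rw [Finset.sum_comm]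
    simp

/-! ### The strata -/

theorem span_singleton_eq_iff_exists {n : ℕ} {w w' : EuclideanSpace ℝ (Fin n)} (hw' : w' ≠ 0)
    (h : Submodule.span ℝ {w} = Submodule.span ℝ {w'}) : ∃ c : ℝ, c ≠ 0 ∧ w' = c • w := by
  have : w' ∈ Submodule.span ℝ {w} := h ▸ Submodule.mem_span_singleton_self w'
  obtain ⟨c, rfl⟩ := Submodule.mem_span_singleton.1 this
  exact ⟨c, by rintro rfl; simp at hw', rfl⟩

theorem signVec_smul {n : ℕ} {c : ℝ} (hc : c ≠ 0) (w : EuclideanSpace ℝ (Fin n)) :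
    signVec (c • w) = signVec w ∨ signVec (c • w) = -signVec w := by
  rcases lt_or_gt_of_ne hc with h | h
  · right; funext i; simp [signVec, sign_mul, sign_neg h]
  · left; funext i; simp [signVec, sign_mul, sign_pos h]

theorem stratum_neg {n : ℕ} (W : Submodule ℝ (EuclideanSpace ℝ (Fin n)))
    (σ : Fin n → SignType) : stratum W (-σ) = stratum W σ := by
  simp only [stratum, neg_neg, or_comm]

theorem eq_or_eq_neg_of_mem_stratum {n : ℕ} {W : Submodule ℝ (EuclideanSpace ℝ (Fin n))}
    {σ σ' : Fin n → SignType} {X : Submodule ℝ (EuclideanSpace ℝ (Fin n))}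
    (h : X ∈ stratum W σ) (h' : X ∈ stratum W σ') : σ' = σ ∨ σ' = -σ := by
  obtain ⟨w, -, -, hs, rfl⟩ := h
  obtain ⟨w', -, hw', hs', he⟩ := h'
  obtain ⟨c, hc, rfl⟩ := span_singleton_eq_iff_exists hw' he
  rcases signVec_smul hc w with h1 | h1 <;> rw [h1] at hs' <;>
    rcases hs with h2 | h2 <;> rw [h2] at hs' <;> rcases hs' with h3 | h3
  · exact Or.inl h3.symm
  · exact Or.inr (by rw [h3, neg_neg])
  · exact Or.inr h3.symm
  · exact Or.inl (neg_injective h3).symm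
  · exact Or.inr h3.symm
  · exact Or.inl (neg_injective h3).symm
  · exact Or.inl (by rw [← h3, neg_neg])
  · exact Or.inr (by rw [neg_neg] at h3; rw [h3, neg_neg])

theorem stratum_eq_of_mem {n : ℕ} {W : Submodule ℝ (EuclideanSpace ℝ (Fin n))}
    {σ σ' : Fin n → SignType} {X : Submodule ℝ (EuclideanSpace ℝ (Fin n))}
    (h : X ∈ stratum W σ) (h' : X ∈ stratum W σ') : stratum W σ = stratum W σ' := by
  rcases eq_or_eq_neg_of_mem_stratum h h' with rfl | rfl
  · rfl
  · rw [stratum_neg]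

theorem pairwiseDisjoint_strata {n : ℕ} (k : ℕ) (W : Submodule ℝ (EuclideanSpace ℝ (Fin n))) :
    (strata k W).PairwiseDisjoint id := by
  rintro _ ⟨σ, -, -, rfl⟩ _ ⟨σ', -, -, rfl⟩ hne
  refine Set.disjoint_left.2 fun X h h' => hne (stratum_eq_of_mem h h')

/-- By duality σ has the signs of some v in W supported on n - k positions. The k remaining
coordinates can be prescribed freely in W, and a small multiple of such a vector added to v supplies
the missing signs. -/
theorem exists_mem_signVec_eq {n k : ℕ} {W : Submodule ℝ (EuclideanSpace ℝ (Fin n))}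
    (hW : W ∈ grPos (k + 1) n) {σ : Fin n → SignType} (hσ : σ ≠ 0) (hk : varBar σ = k) :
    ∃ w ∈ W, w ≠ 0 ∧ signVec w = σ := by
  classical
  have hkn := grPos_le hW
  rw [varBar_eq hσ] at hk
  obtain ⟨Q, a, ha, hQ⟩ := exists_alternating (altSign σ) (altSign_ne_zero hσ)
    (m := n - (k + 1)) (by omega)
  obtain ⟨v, hv, hv0, hvQ⟩ := exists_mem_grPos_alternating hW (by omega) Q ha
  obtain ⟨u, hu, huQ⟩ := exists_mem_grPos_eq hW (Finset.univ.map Q.toEmbedding)ᶜ (by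
    rw [Finset.card_compl, Finset.card_map]; simp; omega) fun i => (σ i : ℝ)
  obtain ⟨ε, hε, hs⟩ := exists_signVec_add_smul v u
  have hsig : signVec (v + ε • u) = σ := by
    funext i
    rw [hs]
    by_cases hi : i ∈ Set.range Q
    · obtain ⟨j, rfl⟩ := hi
      have h1 : signVec v (Q j) = σ (Q j) := by
        rw [← altSign_altSign (signVec v), ← altSign_altSign σ, altSign, hvQ, ← hQ]
        rfl
      have h2 : signVec v (Q j) ≠ 0 := by
        intro h2
        have h3 := hvQ j
        rw [altSign, h2, mul_zero] at h3
        exact mul_ne_zero (pow_ne_zero _ (by decide)) ha h3.symm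
      rw [if_neg ((signVec_eq_zero_iff v _).not.1 h2), h1]
    · rw [if_pos (hv0 i hi), signVec, huQ i (by simpa using hi)]
      cases σ i <;> simp
  refine ⟨v + ε • u, W.add_mem hv (W.smul_mem _ hu), ?_, hsig⟩
  rintro h0
  apply hσ
  rw [← hsig, h0]
  funext i
  simp [signVec]

theorem stratum_nonempty {n k : ℕ} {W : Submodule ℝ (EuclideanSpace ℝ (Fin n))}
    (hW : W ∈ grPos (k + 1) n) {σ : Fin n → SignType} (hσ : σ ≠ 0) (hk : varBar σ = k) :
    (stratum W σ).Nonempty := by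
  obtain ⟨w, hw, hw0, hs⟩ := exists_mem_signVec_eq hW hσ hk
  exact ⟨_, w, hw, hw0, Or.inl hs, rfl⟩

theorem sUnion_strata {n k : ℕ} {W : Submodule ℝ (EuclideanSpace ℝ (Fin n))}
    (hW : W ∈ grPos (k + 1) n) : ⋃₀ strata k W = amplituhedron k W := by
  ext X
  constructor
  · rintro ⟨_, ⟨σ, hσ, hk, rfl⟩, w, hw, hw0, hs, rfl⟩
    have hk' : varBar (signVec w) = k := by
      rcases hs with hs | hs <;> rw [hs]
      · exact hk
      · rw [varBar_neg hσ, hk]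
    obtain ⟨V, hV, hwV⟩ := exists_grNonneg_orthogonal hW hw hw0 hk'
    exact ⟨V, hV, (inf_eq_span_singleton hV hW ⟨hwV, hw⟩ hw0).symm⟩
  · rintro ⟨V, hV, rfl⟩
    obtain ⟨w, hw, hw0⟩ := exists_mem_inf_ne_zero hV hW
    exact ⟨_, ⟨signVec w, signVec_ne_zero hw0, varBar_eq_of_mem_inf hV hW hw hw0, rfl⟩, w, hw.2,
      hw0, Or.inl rfl, inf_eq_span_singleton hV hW hw hw0⟩

/-- The vectors of `W` which vanish where `σ` does. -/
def zeroSubspace {n : ℕ} (W : Submodule ℝ (EuclideanSpace ℝ (Fin n))) (σ : Fin n → SignType) :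
    Submodule ℝ (EuclideanSpace ℝ (Fin n)) :=
  W ⊓ ⨅ i : {i // σ i = 0}, LinearMap.ker (EuclideanSpace.proj (𝕜 := ℝ) (i : Fin n)).toLinearMap

theorem mem_zeroSubspace {n : ℕ} {W : Submodule ℝ (EuclideanSpace ℝ (Fin n))}
    {σ : Fin n → SignType} {v : EuclideanSpace ℝ (Fin n)} :
    v ∈ zeroSubspace W σ ↔ v ∈ W ∧ ∀ i, σ i = 0 → v i = 0 := by
  simp [zeroSubspace]

/-- The vectors with sign σ are open in `zeroSubspace W σ`: moving slightly in any direction v of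
that subspace keeps the sign, so v is a multiple of a difference of two such vectors. -/
theorem sSup_stratum {n k : ℕ} {W : Submodule ℝ (EuclideanSpace ℝ (Fin n))}
    (hW : W ∈ grPos (k + 1) n) {σ : Fin n → SignType} (hσ : σ ≠ 0) (hk : varBar σ = k) :
    sSup (stratum W σ) = zeroSubspace W σ := by
  apply le_antisymm
  · refine sSup_le ?_
    rintro _ ⟨w, hw, -, hs, rfl⟩
    rw [Submodule.span_singleton_le_iff_mem, mem_zeroSubspace]
    refine ⟨hw, fun i hi => (signVec_eq_zero_iff w i).1 ?_⟩
    rcases hs with hs | hs <;> simp [hs, hi]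
  · intro v hv
    rw [mem_zeroSubspace] at hv
    obtain ⟨w, hw, hw0, hs⟩ := exists_mem_signVec_eq hW hσ hk
    have hmem : ∀ u ∈ W, signVec u = σ → u ∈ sSup (stratum W σ) := by
      intro u hu hus
      have hu0 : u ≠ 0 := by
        rintro rfl
        apply hσ
        rw [← hus]
        funext i
        simp [signVec]
      have hS : Submodule.span ℝ {u} ∈ stratum W σ := ⟨u, hu, hu0, Or.inl hus, rfl⟩
      exact (le_sSup hS)
        (Submodule.mem_span_singleton_self u)
    obtain ⟨ε, hε, hsgn⟩ := exists_signVec_add_smul w v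
    have h1 : w + ε • v ∈ sSup (stratum W σ) := by
      refine hmem _ (W.add_mem hw (W.smul_mem _ hv.1)) (funext fun i => ?_)
      rw [hsgn]
      split_ifs with h
      · have hσi : σ i = 0 := by rw [← hs, signVec_eq_zero_iff, h]
        rw [hσi, signVec_eq_zero_iff, hv.2 i hσi]
      · rw [hs]
    have h2 := Submodule.smul_mem _ ε⁻¹ (Submodule.sub_mem _ h1 (hmem w hw hs))
    rwa [add_sub_cancel_left, smul_smul, inv_mul_cancel₀ hε.ne', one_smul] at h2

theorem zeros_le {n k : ℕ} {W : Submodule ℝ (EuclideanSpace ℝ (Fin n))}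
    (hW : W ∈ grPos (k + 1) n) {σ : Fin n → SignType} (hσ : σ ≠ 0) (hk : varBar σ = k) :
    zeros σ ≤ k := by
  classical
  by_contra! hc
  obtain ⟨w, hw, hw0, hs⟩ := exists_mem_signVec_eq hW hσ hk
  refine hw0 (eq_zero_of_mem_grPos hW hw (Finset.univ.filter fun i => σ i = 0) ?_ fun i hi => ?_)
  · rw [zeros] at hc
    convert Nat.succ_le_of_lt hc
  · rw [← signVec_eq_zero_iff, hs]
    simpa using hi

theorem finrank_zeroSubspace {n k : ℕ} {W : Submodule ℝ (EuclideanSpace ℝ (Fin n))}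
    (hW : W ∈ grPos (k + 1) n) {σ : Fin n → SignType} (hσ : σ ≠ 0) (hk : varBar σ = k) :
    Module.finrank ℝ (zeroSubspace W σ) = k - zeros σ + 1 := by
  classical
  have hz := zeros_le hW hσ hk
  let L : W →ₗ[ℝ] ({i // σ i = 0} → ℝ) :=
    LinearMap.pi fun i => (EuclideanSpace.proj (𝕜 := ℝ) (i : Fin n)).toLinearMap ∘ₗ W.subtype
  have hcard : Fintype.card {i // σ i = 0} = zeros σ := by
    rw [Fintype.card_subtype, zeros]
  have hsurj : Function.Surjective L := by
    intro y
    obtain ⟨v, hv, h⟩ := exists_mem_grPos_eq hW (Finset.univ.filter fun i => σ i = 0) (by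
      rw [← Fintype.card_subtype, hcard]; omega) fun i => if h : σ i = 0 then y ⟨i, h⟩ else 0
    refine ⟨⟨v, hv⟩, funext fun i => ?_⟩
    have := h i (by simpa using i.2)
    rw [dif_pos i.2] at this
    exact this
  have h1 := LinearMap.finrank_range_add_finrank_ker L
  rw [LinearMap.range_eq_top.2 hsurj, finrank_top, Module.finrank_fintype_fun_eq_card,
    grPos_finrank hW, hcard] at h1
  have h2 : zeroSubspace W σ = (LinearMap.ker L).map W.subtype := by
    ext v
    rw [mem_zeroSubspace, Submodule.mem_map]
    constructor
    · rintro ⟨hv, h⟩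
      exact ⟨⟨v, hv⟩, LinearMap.mem_ker.2 (funext fun i => h i i.2), rfl⟩
    · rintro ⟨v, hv, rfl⟩
      exact ⟨v.2, fun i hi => congrFun (LinearMap.mem_ker.1 hv) ⟨i, hi⟩⟩
  rw [h2, Submodule.finrank_map_subtype_eq]
  omega

theorem dim_stratum {n k : ℕ} {W : Submodule ℝ (EuclideanSpace ℝ (Fin n))}
    (hW : W ∈ grPos (k + 1) n) {σ : Fin n → SignType} (hσ : σ ≠ 0) (hk : varBar σ = k) :
    dim (stratum W σ) = k - zeros σ := by
  rw [dim, sSup_stratum hW hσ hk, finrank_zeroSubspace hW hσ hk, Nat.add_sub_cancel]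

end

/-! ### The generating function -/

section

open Polynomial

theorem neg_ne_self {n : ℕ} {σ : Fin n → SignType} (hσ : σ ≠ 0) : -σ ≠ σ := by
  obtain ⟨i, hi⟩ := Function.ne_iff.1 hσ
  exact fun h => SignType.ne_neg hi (congrFun h i).symm

open Classical in
-- Each stratum comes from exactly two sign vectors, σ and -σ. The factor 2 avoids choosing
-- representatives.
theorem two_mul_genFun {n k : ℕ} {W : Submodule ℝ (EuclideanSpace ℝ (Fin n))}
    (hW : W ∈ grPos (k + 1) n) :
    2 * genFun k W =
      ∑ σ : Fin n → SignType with σ ≠ 0 ∧ varBar σ = k, (X : ℕ[X]) ^ (k - zeros σ) := by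
  set T : Finset (Fin n → SignType) := Finset.univ.filter fun σ => σ ≠ 0 ∧ varBar σ = k with hT
  have hmem : ∀ σ, σ ∈ T ↔ σ ≠ 0 ∧ varBar σ = k := fun σ => by simp [hT]
  have himg : (strata_finite k W).toFinset = T.image (stratum W) := by
    ext S
    simp only [Set.Finite.mem_toFinset, Finset.mem_image, hmem]
    constructor
    · rintro ⟨σ, h1, h2, rfl⟩; exact ⟨σ, ⟨h1, h2⟩, rfl⟩
    · rintro ⟨σ, ⟨h1, h2⟩, rfl⟩; exact ⟨σ, h1, h2, rfl⟩
  have h1 : ∑ σ ∈ T, (X : ℕ[X]) ^ (k - zeros σ) = ∑ σ ∈ T, (X : ℕ[X]) ^ dim (stratum W σ) :=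
    Finset.sum_congr rfl fun σ hσ => by
      rw [dim_stratum hW ((hmem σ).1 hσ).1 ((hmem σ).1 hσ).2]
  rw [h1, Finset.sum_comp (fun S => (X : ℕ[X]) ^ dim S) (stratum W), genFun, himg, Finset.mul_sum]
  refine Finset.sum_congr rfl fun S hS => ?_
  obtain ⟨σ, hσ, rfl⟩ := Finset.mem_image.1 hS
  obtain ⟨hσ0, hσk⟩ := (hmem σ).1 hσ
  have hfib : (T.filter fun τ => stratum W τ = stratum W σ) = {-σ, σ} := by
    ext τ
    rw [Finset.mem_filter, hmem, Finset.mem_insert, Finset.mem_singleton]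
    constructor
    · rintro ⟨-, h⟩
      obtain ⟨X, hX⟩ := stratum_nonempty hW hσ0 hσk
      exact (eq_or_eq_neg_of_mem_stratum hX (h ▸ hX)).symm
    · rintro (rfl | rfl)
      · refine ⟨⟨fun h => hσ0 ?_, by rw [varBar_neg hσ0, hσk]⟩, stratum_neg W σ⟩
        funext i
        simpa using congrFun h i
      · exact ⟨⟨hσ0, hσk⟩, rfl⟩
  rw [hfib, Finset.card_pair (neg_ne_self hσ0), nsmul_eq_mul, Nat.cast_ofNat]

/-- `altSign` as a permutation of the sign vectors. -/
def altSignEquiv (n : ℕ) : (Fin n → SignType) ≃ (Fin n → SignType) where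
  toFun := altSign
  invFun := altSign
  left_inv := altSign_altSign
  right_inv := altSign_altSign

open Classical in
theorem card_varBar {n k z : ℕ} (hk : k < n) (hz : z ≤ k) :
    (Finset.univ.filter fun σ : Fin n → SignType =>
      (σ ≠ 0 ∧ varBar σ = k) ∧ zeros σ = z).card =
      2 * ((n - k - 1 + (k - z)).choose (k - z) * n.choose z) := by
  have h := card_signChanges n (n - k - 1) z
  rw [if_pos (by omega), ← (altSignEquiv n).sum_comp] at h
  rw [Finset.card_filter]
  have e : n - z - 1 = n - k - 1 + (k - z) := by omega
  rw [e, Nat.choose_symm_add] at h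
  rw [mul_comm ((n - k - 1 + (k - z)).choose (k - z)), ← h]
  refine Finset.sum_congr rfl fun σ _ => if_congr ?_ rfl rfl
  have h0 : altSign σ ≠ 0 ↔ σ ≠ 0 :=
    ⟨fun h h' => h (by rw [h']; funext i; simp [altSign]), altSign_ne_zero⟩
  change _ ↔ altSign σ ≠ 0 ∧ signChanges n 0 (altSign σ) = _ ∧ zeros (altSign σ) = z
  rw [h0, zeros_altSign, and_assoc]
  refine and_congr_right fun hσ => and_congr_left fun _ => ?_
  rw [varBar_eq hσ]
  omega

theorem genFun_eq {n k : ℕ} {W : Submodule ℝ (EuclideanSpace ℝ (Fin n))}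
    (hW : W ∈ grPos (k + 1) n) :
    genFun k W = ∑ i ∈ Finset.range (k + 1),
      C ((n - k - 1 + i).choose i * n.choose (k - i)) * X ^ i := by
  classical
  have hkn : k < n := grPos_le hW
  have h2 : 2 * genFun k W = 2 * ∑ i ∈ Finset.range (k + 1),
      C ((n - k - 1 + i).choose i * n.choose (k - i)) * X ^ i := by
    rw [two_mul_genFun hW, ← Finset.sum_fiberwise_of_maps_to (t := Finset.range (k + 1))
      (g := fun σ => k - zeros σ) (fun σ _ => Finset.mem_range.2 (by omega)), Finset.mul_sum]
    refine Finset.sum_congr rfl fun i hi => ?_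
    have hik : i ≤ k := Nat.lt_succ_iff.1 (Finset.mem_range.1 hi)
    rw [Finset.sum_congr rfl fun σ hσ => by rw [(Finset.mem_filter.1 hσ).2], Finset.sum_const,
      nsmul_eq_mul]
    have hf : (Finset.univ.filter fun σ : Fin n → SignType => σ ≠ 0 ∧ varBar σ = k).filter
        (fun σ => k - zeros σ = i) = Finset.univ.filter fun σ : Fin n → SignType =>
          (σ ≠ 0 ∧ varBar σ = k) ∧ zeros σ = k - i := by
      ext σ
      simp only [Finset.mem_filter, Finset.mem_univ, true_and]
      refine and_congr_right fun ⟨h1, h2⟩ => ?_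
      have := zeros_le hW h1 h2
      omega
    rw [hf, card_varBar hkn (by omega), Nat.sub_sub_self hik]
    simp [mul_assoc]
  exact mul_left_cancel₀ two_ne_zero h2

theorem sum_range_add_choose (b d : ℕ) :
    ∑ t ∈ Finset.range (d + 1), (b + t).choose t = (b + d + 1).choose d := by
  induction d with
  | zero => simp
  | succ d ih =>
    rw [Finset.sum_range_succ, ih, ← add_assoc, Nat.choose_succ_succ (b + d + 1)]

/-- Compares coefficients of q^i in the two formulas. With a = n - k - 1, rewrite the summand as
C(a+i, i) C(a+j, j-i) and sum over j by the hockey-stick identity. -/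
theorem sum_choose_mul_choose {n k i : ℕ} (hk : k < n) (hi : i ≤ k) :
    ∑ j ∈ Finset.range (k + 1), (n - k - 1 + j).choose j * j.choose i =
      (n - k - 1 + i).choose i * n.choose (k - i) := by
  obtain ⟨a, rfl⟩ : ∃ a, n = a + k + 1 := ⟨n - k - 1, by omega⟩
  obtain ⟨d, rfl⟩ := Nat.exists_eq_add_of_le hi
  rw [show a + (i + d) + 1 - (i + d) - 1 = a by omega, Nat.add_sub_cancel_left,
    show i + d + 1 = i + (d + 1) by ring, Finset.sum_range_add, Finset.sum_eq_zero, zero_add]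
  · have h : ∀ t, (a + (i + t)).choose (i + t) * (i + t).choose i =
        (a + i).choose i * (a + i + t).choose t := by
      intro t
      rw [Nat.choose_symm_add, Nat.choose_mul (Nat.le_add_left t i), mul_comm, ← add_assoc,
        Nat.add_sub_cancel, Nat.add_sub_cancel]
    simp only [h, ← Finset.mul_sum]
    rw [sum_range_add_choose, show a + (i + d) + 1 = a + i + d + 1 by ring]
  · intro j hj
    rw [Nat.choose_eq_zero_of_lt (Finset.mem_range.1 hj), mul_zero]

theorem genFun_eq' {n k : ℕ} {W : Submodule ℝ (EuclideanSpace ℝ (Fin n))}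
    (hW : W ∈ grPos (k + 1) n) :
    genFun k W = ∑ j ∈ Finset.range (k + 1),
      C ((n - k - 1 + j).choose j) * (1 + X) ^ j := by
  rw [genFun_eq hW]
  have hkn : k < n := grPos_le hW
  ext i
  simp only [finsetSum_coeff, coeff_C_mul, coeff_X_pow, mul_ite, mul_one, mul_zero,
    coeff_one_add_X_pow]
  rw [Finset.sum_ite_eq]
  split_ifs with h
  · rw [← sum_choose_mul_choose hkn (Nat.lt_succ_iff.1 (Finset.mem_range.1 h))]
    simp
  · rw [Finset.sum_eq_zero]
    intro j hj
    rw [Finset.mem_range] at h hj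
    simp [Nat.choose_eq_zero_of_lt (show j < i by omega)]

end

section

open Filter Topology Metric

/-! ### The topology on subspaces -/

theorem isInducing_starProjection (n : ℕ) :
    IsInducing fun V : Submodule ℝ (EuclideanSpace ℝ (Fin n)) => V.starProjection := ⟨rfl⟩

instance instT2SpaceSubspaces (n : ℕ) : T2Space (Submodule ℝ (EuclideanSpace ℝ (Fin n))) :=
  T2Space.of_injective_continuous (f := fun V => V.starProjection)
    (fun _ _ h => Submodule.starProjection_inj.1 h) (isInducing_starProjection n).continuous

/-- The projection onto the line of w is v ↦ ⟨w, v⟩ w / ‖w‖², continuous in w away from 0. -/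
theorem continuousOn_span_singleton (n : ℕ) :
    ContinuousOn (fun w : EuclideanSpace ℝ (Fin n) => Submodule.span ℝ {w}) {w | w ≠ 0} := by
  rw [(isInducing_starProjection n).continuousOn_iff]
  have h : ∀ w : EuclideanSpace ℝ (Fin n), (Submodule.span ℝ {w}).starProjection =
      (‖w‖ ^ 2)⁻¹ • (innerSL ℝ w).smulRight w := by
    intro w
    ext1 v
    rw [Submodule.starProjection_singleton]
    simp [smul_smul, div_eq_inv_mul]
  simp only [Function.comp_def, h]
  have hn : ContinuousOn (fun w : EuclideanSpace ℝ (Fin n) => ‖w‖ ^ 2) {w | w ≠ 0} := by fun_prop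
  refine ContinuousOn.smul (hn.inv₀ fun w hw => ?_) ?_
  · simpa using hw
  · have hc : Continuous fun w : EuclideanSpace ℝ (Fin n) =>
        ContinuousLinearMap.smulRightL ℝ (EuclideanSpace ℝ (Fin n)) (EuclideanSpace ℝ (Fin n))
          (innerSL ℝ w) w :=
      ((ContinuousLinearMap.smulRightL ℝ _ _).continuous.comp
        (innerSL ℝ).continuous).clm_apply continuous_id
    exact hc.continuousOn

theorem continuousOn_of_isCompact_of_leftInvOn {X Y : Type*} [TopologicalSpace X]
    [TopologicalSpace Y] [T2Space Y] {f : X → Y} {g : Y → X} {K : Set X} (hK : IsCompact K)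
    (hf : ContinuousOn f K) (hg : Set.LeftInvOn g f K) : ContinuousOn g (f '' K) := by
  rw [continuousOn_iff_isClosed]
  intro F hF
  refine ⟨f '' (K ∩ F), ((hK.inter_right hF).image_of_continuousOn
    (hf.mono Set.inter_subset_left)).isClosed, ?_⟩
  ext y
  constructor
  · rintro ⟨hy, x, hx, rfl⟩
    refine ⟨⟨x, ⟨hx, ?_⟩, rfl⟩, x, hx, rfl⟩
    rw [Set.mem_preimage, hg hx] at hy
    exact hy
  · rintro ⟨⟨x, ⟨hx, hxF⟩, rfl⟩, hy⟩
    refine ⟨?_, hy⟩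
    rw [Set.mem_preimage, hg hx]
    exact hxF

/-! ### Characteristic maps -/

/-- The linear functional `w ↦ ∑ σᵢ wᵢ`. -/
def signFunctional {n : ℕ} (σ : Fin n → SignType) : EuclideanSpace ℝ (Fin n) →ₗ[ℝ] ℝ :=
  ∑ i, (σ i : ℝ) • (EuclideanSpace.proj (𝕜 := ℝ) i).toLinearMap

theorem signFunctional_apply {n : ℕ} (σ : Fin n → SignType) (w : EuclideanSpace ℝ (Fin n)) :
    signFunctional σ w = ∑ i, (σ i : ℝ) * w i := by
  simp [signFunctional]

theorem sign_mul_pos {n : ℕ} {σ : Fin n → SignType} {w : EuclideanSpace ℝ (Fin n)}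
    (h : signVec w = σ) {i : Fin n} (hi : σ i ≠ 0) : 0 < (σ i : ℝ) * w i := by
  rw [← h] at hi ⊢
  rw [Ne, signVec_eq_zero_iff] at hi
  rcases lt_or_gt_of_ne hi with h | h
  · rw [signVec, sign_neg h]; simpa using h
  · rw [signVec, sign_pos h]; simpa using h

theorem signVec_eq_of_sign_mul_pos {n : ℕ} {σ : Fin n → SignType} {w : EuclideanSpace ℝ (Fin n)}
    {i : Fin n} (h : 0 < (σ i : ℝ) * w i) : signVec w i = σ i := by
  rw [signVec]
  cases hs : σ i <;> rw [hs] at h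
  · simp at h
  · have : w i < 0 := by simpa using h
    rw [sign_neg this]; rfl
  · have : 0 < w i := by simpa using h
    rw [sign_pos this]; rfl

theorem signFunctional_pos {n : ℕ} {σ : Fin n → SignType} (hσ : σ ≠ 0)
    {w : EuclideanSpace ℝ (Fin n)} (h : signVec w = σ) : 0 < signFunctional σ w := by
  rw [signFunctional_apply]
  obtain ⟨i, hi⟩ := Function.ne_iff.1 hσ
  refine Finset.sum_pos' (fun j _ => ?_) ⟨i, Finset.mem_univ _, sign_mul_pos h hi⟩
  by_cases hj : σ j = 0
  · simp [hj]
  · exact (sign_mul_pos h hj).le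

/-- A linear chart of the affine slice `∑ σᵢ wᵢ = 1` of the vectors of `W` which vanish
where `σ` does. -/
theorem exists_chart {n k d : ℕ} {W : Submodule ℝ (EuclideanSpace ℝ (Fin n))}
    (hW : W ∈ grPos (k + 1) n) {σ : Fin n → SignType} (hσ : σ ≠ 0) (hk : varBar σ = k)
    (hd : k - zeros σ = d) :
    ∃ (w₀ : EuclideanSpace ℝ (Fin n)) (e : (Fin d → ℝ) →ₗ[ℝ] EuclideanSpace ℝ (Fin n)),
      signVec w₀ = σ ∧ Function.Injective e ∧
      (∀ x, w₀ + e x ∈ zeroSubspace W σ ∧ signFunctional σ (w₀ + e x) = 1) ∧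
      ∀ v ∈ zeroSubspace W σ, signFunctional σ v = 1 → ∃ x, v = w₀ + e x := by
  obtain ⟨w₁, hw₁, -, hs₁⟩ := exists_mem_signVec_eq hW hσ hk
  have hpos := signFunctional_pos hσ hs₁
  set w₀ := (signFunctional σ w₁)⁻¹ • w₁ with hw₀
  have hs₀ : signVec w₀ = σ := by
    rw [← hs₁]
    funext i
    simp [hw₀, signVec, sign_mul, sign_pos (inv_pos.2 hpos)]
  have hℓ₀ : signFunctional σ w₀ = 1 := by
    rw [hw₀, map_smul, smul_eq_mul, inv_mul_cancel₀ hpos.ne']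
  have hL₀ : w₀ ∈ zeroSubspace W σ := by
    refine mem_zeroSubspace.2 ⟨W.smul_mem _ hw₁, fun i hi => ?_⟩
    rw [← signVec_eq_zero_iff, hs₀, hi]
  set ℓ := (signFunctional σ).comp (zeroSubspace W σ).subtype with hℓ
  have hsurj : Function.Surjective ℓ := fun c =>
    ⟨c • ⟨w₀, hL₀⟩, by simp [hℓ, hℓ₀]⟩
  have hrank := LinearMap.finrank_range_add_finrank_ker ℓ
  rw [LinearMap.range_eq_top.2 hsurj, finrank_top, Module.finrank_self,
    finrank_zeroSubspace hW hσ hk, hd] at hrank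
  let e₀ : (Fin d → ℝ) ≃ₗ[ℝ] LinearMap.ker ℓ := LinearEquiv.ofFinrankEq _ _ (by
    rw [Module.finrank_fintype_fun_eq_card, Fintype.card_fin]; omega)
  have he : ∀ x, signFunctional σ ((e₀ x : zeroSubspace W σ) : EuclideanSpace ℝ (Fin n)) = 0 :=
    fun x => LinearMap.mem_ker.1 (e₀ x).2
  refine ⟨w₀, (zeroSubspace W σ).subtype ∘ₗ (LinearMap.ker ℓ).subtype ∘ₗ e₀.toLinearMap, hs₀,
    ?_, fun x => ⟨?_, ?_⟩, fun v hv hv1 => ?_⟩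
  · exact (Subtype.val_injective.comp Subtype.val_injective).comp e₀.injective
  · exact Submodule.add_mem _ hL₀ (e₀ x : zeroSubspace W σ).2
  · rw [map_add, hℓ₀]
    simpa using he x
  · have hmem : (⟨v - w₀, Submodule.sub_mem _ hv hL₀⟩ : zeroSubspace W σ) ∈ LinearMap.ker ℓ := by
      rw [LinearMap.mem_ker]
      simp [hℓ, hv1, hℓ₀]
    refine ⟨e₀.symm ⟨_, hmem⟩, ?_⟩
    simp

/-- In the chart, the closed cone of σ becomes a compact convex body of dimension d, hence a ball.
The slice meets each line at most once, which gives injectivity. -/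
theorem exists_characteristic_map {n k d : ℕ} {W : Submodule ℝ (EuclideanSpace ℝ (Fin n))}
    (hW : W ∈ grPos (k + 1) n) {σ : Fin n → SignType} (hσ : σ ≠ 0) (hk : varBar σ = k)
    (hd : k - zeros σ = d) :
    ∃ φ : (Fin d → ℝ) → Submodule ℝ (EuclideanSpace ℝ (Fin n)),
      Continuous φ ∧ Function.Injective φ ∧ φ '' ball 0 1 = stratum W σ ∧
      ∀ x ∈ sphere (0 : Fin d → ℝ) 1, ∃ σ' : Fin n → SignType, σ' ≠ 0 ∧ varBar σ' = k ∧
        k - zeros σ' < d ∧ φ x ∈ stratum W σ' := by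
  obtain ⟨w₀, e, hs₀, he, hmem, hex⟩ := exists_chart hW hσ hk hd
  have hcont : Continuous fun x => w₀ + e x :=
    continuous_const.add e.continuous_of_finiteDimensional
  have hci : ∀ i, Continuous fun x => (σ i : ℝ) * (w₀ + e x) i := fun i =>
    continuous_const.mul ((EuclideanSpace.proj (𝕜 := ℝ) i).continuous.comp hcont)
  have hne : ∀ x, w₀ + e x ≠ 0 := by
    intro x h
    have := (hmem x).2
    rw [h, map_zero] at this
    exact zero_ne_one this
  let s : Set (Fin d → ℝ) := {x | ∀ i, 0 ≤ (σ i : ℝ) * (w₀ + e x) i}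
  let s' : Set (Fin d → ℝ) := {x | ∀ i, σ i ≠ 0 → 0 < (σ i : ℝ) * (w₀ + e x) i}
  have hs's : s' ⊆ s := by
    intro x hx i
    by_cases hi : σ i = 0
    · simp [hi]
    · exact (hx i hi).le
  have hclosed : IsClosed s := by
    simp only [s, Set.ofPred_forall]
    exact isClosed_iInter fun i => isClosed_le continuous_const (hci i)
  have hopen : IsOpen s' := by
    simp only [s', Set.ofPred_forall]
    exact isOpen_iInter_of_finite fun i => isOpen_iInter_of_finite fun _ =>
      isOpen_lt continuous_const (hci i)
  have haff : ∀ (i : Fin n) (x y : Fin d → ℝ) (a b : ℝ), a + b = 1 →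
      (σ i : ℝ) * (w₀ + e (a • x + b • y)) i =
        a * ((σ i : ℝ) * (w₀ + e x) i) + b * ((σ i : ℝ) * (w₀ + e y) i) := by
    intro i x y a b hab
    have : b = 1 - a := by linarith
    subst this
    simp
    ring
  have hconv : Convex ℝ s := by
    intro x hx y hy a b ha hb hab i
    rw [haff i x y a b hab]
    exact add_nonneg (mul_nonneg ha (hx i)) (mul_nonneg hb (hy i))
  have h0 : (0 : Fin d → ℝ) ∈ s' := by
    intro i hi
    rw [map_zero, add_zero]
    exact sign_mul_pos hs₀ hi
  -- If a coordinate in the support of σ vanished at an interior point x, moving beyond x away from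
  -- the origin of the chart, where it is positive, would make it negative.
  have hint : interior s = s' := by
    refine Set.Subset.antisymm ?_ (interior_maximal hs's hopen)
    intro x hx i hi
    have hx1 : x ∈ s := interior_subset hx
    refine (hx1 i).lt_of_ne' fun hxi => ?_
    have hline : Tendsto (fun t : ℝ => (1 + t) • x + (-t) • (0 : Fin d → ℝ)) (𝓝[>] 0) (𝓝 x) := by
      have : Continuous fun t : ℝ => (1 + t) • x + (-t) • (0 : Fin d → ℝ) := by fun_prop
      have h := this.tendsto 0
      simp only [add_zero, one_smul, neg_zero, zero_smul] at h
      exact h.mono_left nhdsWithin_le_nhds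
    obtain ⟨t, ht1, ht2⟩ := ((hline.eventually (isOpen_interior.mem_nhds hx)).and
      self_mem_nhdsWithin).exists
    have h1 := (interior_subset ht1 : _ ∈ s) i
    rw [haff i _ _ _ _ (by ring), hxi, mul_zero, zero_add] at h1
    have h2 : 0 < t * ((σ i : ℝ) * (w₀ + e 0) i) := mul_pos ht2 (h0 i hi)
    linarith
  -- The numbers σᵢ wᵢ are nonnegative with sum 1, so all coordinates are at most 1 in absolute
  -- value; injectivity of e transfers the bound to the chart.
  have hbdd : Bornology.IsBounded s := by
    obtain ⟨c, -, hc⟩ := e.exists_antilipschitzWith (LinearMap.ker_eq_bot.2 he)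
    have hb : Bornology.IsBounded (e ⁻¹' (closedBall (-w₀) (n : ℝ))) :=
      hc.isBounded_preimage isBounded_closedBall
    refine hb.subset fun x hx => ?_
    rw [Set.mem_preimage, mem_closedBall, dist_eq_norm, sub_neg_eq_add, add_comm]
    have hle : ∀ i, ‖(w₀ + e x) i‖ ≤ 1 := by
      intro i
      by_cases hi : σ i = 0
      · rw [(mem_zeroSubspace.1 (hmem x).1).2 i hi]; simp
      · have h1 := (hmem x).2
        rw [signFunctional_apply] at h1
        have h2 := Finset.single_le_sum (f := fun i => (σ i : ℝ) * (w₀ + e x) i)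
          (fun j _ => hx j) (Finset.mem_univ i)
        rw [h1] at h2
        have h3 := hx i
        have h4 : ‖(w₀ + e x) i‖ = (σ i : ℝ) * (w₀ + e x) i := by
          rw [← abs_of_nonneg h3, abs_mul]
          cases hs : σ i
          · exact absurd hs hi
          · simp
          · simp
        rw [h4]; exact h2
    rw [EuclideanSpace.norm_eq]
    apply Real.sqrt_le_iff.2 ⟨by positivity, ?_⟩
    calc ∑ i, ‖(w₀ + e x) i‖ ^ 2 ≤ ∑ _i : Fin n, (1 : ℝ) :=
          Finset.sum_le_sum fun i _ => pow_le_one₀ (norm_nonneg _) (hle i)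
      _ = n := by simp
      _ ≤ (n : ℝ) ^ 2 := by exact_mod_cast Nat.le_self_pow two_ne_zero n
  obtain ⟨h, hball, -, hsphere⟩ := exists_homeomorph_image_interior_closure_frontier_eq_unitBall
    hconv (hint ▸ ⟨0, h0⟩) hbdd
  refine ⟨fun y => Submodule.span ℝ {w₀ + e (h.symm y)}, ?_, ?_, ?_, ?_⟩
  · exact (continuousOn_span_singleton n).comp_continuous (hcont.comp h.symm.continuous)
      fun y => hne _
  · intro y y' hyy
    obtain ⟨c, -, hc⟩ := span_singleton_eq_iff_exists (hne _) hyy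
    have h1 := congrArg (signFunctional σ) hc
    rw [map_smul, (hmem _).2, (hmem _).2, smul_eq_mul, mul_one] at h1
    rw [← h1, one_smul] at hc
    exact h.symm.injective (he (add_left_cancel hc)).symm
  · rw [← hball, Set.image_image, hint]
    simp only [Homeomorph.symm_apply_apply]
    ext X
    constructor
    · rintro ⟨x, hx, rfl⟩
      refine ⟨_, (mem_zeroSubspace.1 (hmem x).1).1, hne x, Or.inl (funext fun i => ?_), rfl⟩
      by_cases hi : σ i = 0
      · rw [hi, signVec_eq_zero_iff]
        exact (mem_zeroSubspace.1 (hmem x).1).2 i hi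
      · exact signVec_eq_of_sign_mul_pos (hx i hi)
    · have key : ∀ w ∈ W, signVec w = σ → Submodule.span ℝ {w} ∈
          (fun x => Submodule.span ℝ {w₀ + e x}) '' s' := by
        intro w hw hs
        have hp := signFunctional_pos hσ hs
        have hwL : w ∈ zeroSubspace W σ :=
          mem_zeroSubspace.2 ⟨hw, fun i hi => by rw [← signVec_eq_zero_iff, hs, hi]⟩
        obtain ⟨x, hx⟩ := hex ((signFunctional σ w)⁻¹ • w) (Submodule.smul_mem _ _ hwL)
          (by rw [map_smul, smul_eq_mul, inv_mul_cancel₀ hp.ne'])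
        refine ⟨x, fun i hi => ?_, ?_⟩
        · rw [← hx]
          have := mul_pos (inv_pos.2 hp) (sign_mul_pos hs hi)
          simp only [PiLp.smul_apply, smul_eq_mul]
          linarith
        · change Submodule.span ℝ {w₀ + e x} = _
          rw [← hx]
          exact Submodule.span_singleton_smul_eq (IsUnit.mk0 _ (inv_ne_zero hp.ne')) w
      rintro ⟨w, hw, -, hs | hs, rfl⟩
      · exact key w hw hs
      · rw [← Submodule.span_neg {w}, Set.neg_singleton]
        refine key (-w) (W.neg_mem hw) ?_
        rw [signVec_neg, hs, neg_neg]
  · intro y hy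
    rw [← hsphere] at hy
    obtain ⟨x, hx, rfl⟩ := hy
    rw [hclosed.frontier_eq, hint] at hx
    obtain ⟨hx1, hx2⟩ := hx
    simp only [Homeomorph.symm_apply_apply]
    have hxW := (mem_zeroSubspace.1 (hmem x).1).1
    have href : Refines σ (signVec (w₀ + e x)) := by
      intro i hi
      refine (signVec_eq_of_sign_mul_pos ((hx1 i).lt_of_ne' (mul_ne_zero ?_ ?_))).symm
      · refine SignType.cast_ne_zero fun h => hi ?_
        rw [signVec_eq_zero_iff]
        exact (mem_zeroSubspace.1 (hmem x).1).2 i h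
      · rwa [Ne, signVec_eq_zero_iff] at hi
    -- Passing to the boundary only creates zeros, so `varBar` is still at least k; lying in W
    -- bounds it by k.
    have hvar : varBar (signVec (w₀ + e x)) = k := by
      have h1 := href.varBar_le
      have h2 := varBar_lt_of_mem_grPos hW hxW (hne x)
      push_cast at h2
      omega
    have hzero : zeros σ < zeros (signVec (w₀ + e x)) := by
      classical
      simp only [s', Set.mem_ofPred_eq, not_forall] at hx2
      obtain ⟨i, hi, hxi⟩ := hx2
      refine Finset.card_lt_card (Finset.ssubset_iff_subset_ne.2 ⟨?_, ?_⟩)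
      · intro j hj
        rw [Finset.mem_filter] at hj ⊢
        refine ⟨Finset.mem_univ _, ?_⟩
        rw [signVec_eq_zero_iff]
        exact (mem_zeroSubspace.1 (hmem x).1).2 j hj.2
      · intro heq
        have hi' : i ∈ Finset.univ.filter fun i => signVec (w₀ + e x) i = 0 := by
          rw [Finset.mem_filter, signVec_eq_zero_iff]
          refine ⟨Finset.mem_univ _, ?_⟩
          have h1 := le_antisymm (not_lt.1 hxi) (hx1 i)
          exact (mul_eq_zero.1 h1).resolve_left (SignType.cast_ne_zero hi)
        have hi2 : i ∈ Finset.univ.filter fun i => σ i = 0 := by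
          convert hi'
        exact hi (Finset.mem_filter.1 hi2).2
    refine ⟨_, signVec_ne_zero (hne x), hvar, ?_, _, hxW, hne x, Or.inl rfl, rfl⟩
    have := zeros_le hW (signVec_ne_zero (hne x)) hvar
    omega

end

/-! ### The CW structure and the Euler characteristic -/

section

open Filter Topology Metric

theorem exists_cell_map {n k d : ℕ} {W : Submodule ℝ (EuclideanSpace ℝ (Fin n))}
    (hW : W ∈ grPos (k + 1) n) {S : Set (Submodule ℝ (EuclideanSpace ℝ (Fin n)))}
    (hS : S ∈ strata k W) (hd : dim S = d) :
    ∃ φ : (Fin d → ℝ) → Submodule ℝ (EuclideanSpace ℝ (Fin n)),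
      Continuous φ ∧ Function.Injective φ ∧ φ '' ball 0 1 = S ∧
      ∀ x ∈ sphere (0 : Fin d → ℝ) 1, ∃ S' ∈ strata k W, dim S' < d ∧ φ x ∈ S' := by
  obtain ⟨σ, hσ, hk, rfl⟩ := hS
  rw [dim_stratum hW hσ hk] at hd
  obtain ⟨φ, h1, h2, h3, h4⟩ := exists_characteristic_map hW hσ hk hd
  refine ⟨φ, h1, h2, h3, fun x hx => ?_⟩
  obtain ⟨σ', hσ', hk', hd', hx'⟩ := h4 x hx
  exact ⟨_, ⟨σ', hσ', hk', rfl⟩, by rwa [dim_stratum hW hσ' hk'], hx'⟩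

theorem dim_le {n k : ℕ} {W : Submodule ℝ (EuclideanSpace ℝ (Fin n))}
    (hW : W ∈ grPos (k + 1) n) {S : Set (Submodule ℝ (EuclideanSpace ℝ (Fin n)))}
    (hS : S ∈ strata k W) : dim S ≤ k := by
  obtain ⟨σ, hσ, hk, rfl⟩ := hS
  rw [dim_stratum hW hσ hk]
  exact Nat.sub_le _ _

/-- The strata of a given dimension, the index type of the cells. -/
abbrev StrataOfDim {n : ℕ} (k : ℕ) (W : Submodule ℝ (EuclideanSpace ℝ (Fin n))) (d : ℕ) :=
  {S // S ∈ strata k W ∧ dim S = d}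

/-- The characteristic map of a stratum. -/
def cellMap {n k : ℕ} {W : Submodule ℝ (EuclideanSpace ℝ (Fin n))} (hW : W ∈ grPos (k + 1) n)
    {d : ℕ} (S : StrataOfDim k W d) :
    PartialEquiv (Fin d → ℝ) (Submodule ℝ (EuclideanSpace ℝ (Fin n))) :=
  (exists_cell_map hW S.2.1 S.2.2).choose_spec.2.1.injOn.toPartialEquiv _ (ball 0 1)

theorem cellMap_spec {n k : ℕ} {W : Submodule ℝ (EuclideanSpace ℝ (Fin n))}
    (hW : W ∈ grPos (k + 1) n) {d : ℕ} (S : StrataOfDim k W d) :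
    Continuous (cellMap hW S) ∧ Function.Injective (cellMap hW S) ∧
      cellMap hW S '' ball 0 1 = S ∧
      ∀ x ∈ sphere (0 : Fin d → ℝ) 1, ∃ S' ∈ strata k W, dim S' < d ∧ cellMap hW S x ∈ S' :=
  (exists_cell_map hW S.2.1 S.2.2).choose_spec

theorem cellMap_source {n k : ℕ} {W : Submodule ℝ (EuclideanSpace ℝ (Fin n))}
    (hW : W ∈ grPos (k + 1) n) {d : ℕ} (S : StrataOfDim k W d) :
    (cellMap hW S).source = ball 0 1 := rfl

/-- A continuous injection of the compact closed ball into a Hausdorff space has a continuous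
inverse on its image; this is restricted to the open cell. -/
theorem continuousOn_cellMap_symm {n k : ℕ} {W : Submodule ℝ (EuclideanSpace ℝ (Fin n))}
    (hW : W ∈ grPos (k + 1) n) {d : ℕ} (S : StrataOfDim k W d) :
    ContinuousOn (cellMap hW S).symm (cellMap hW S).target := by
  obtain ⟨h1, h2, -, -⟩ := cellMap_spec hW S
  have h := continuousOn_of_isCompact_of_leftInvOn (isCompact_closedBall (0 : Fin d → ℝ) 1)
    h1.continuousOn ((Function.leftInverse_invFun h2).leftInvOn _)
  rw [← (cellMap hW S).image_source_eq_target, cellMap_source]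
  refine (h.mono (Set.image_mono ball_subset_closedBall)).congr ?_
  rintro _ ⟨x, hx, rfl⟩
  rw [(cellMap hW S).left_inv (by rwa [cellMap_source]), Function.leftInverse_invFun h2 x]

theorem finite_strataOfDim {n : ℕ} (k : ℕ) (W : Submodule ℝ (EuclideanSpace ℝ (Fin n))) (d : ℕ) :
    Finite (StrataOfDim k W d) :=
  ((strata_finite k W).subset fun _ h => h.1 : {S | S ∈ strata k W ∧ dim S = d}.Finite).to_subtype

theorem pairwiseDisjoint_cellMap {n k : ℕ} {W : Submodule ℝ (EuclideanSpace ℝ (Fin n))}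
    (hW : W ∈ grPos (k + 1) n) :
    (Set.univ : Set (Σ d, StrataOfDim k W d)).PairwiseDisjoint
      fun S => cellMap hW S.2 '' ball 0 1 := by
  rintro ⟨d, S, hS, hd⟩ - ⟨d', S', hS', hd'⟩ - hne
  simp only [Function.onFun]
  rw [(cellMap_spec hW _).2.2.1, (cellMap_spec hW _).2.2.1]
  refine pairwiseDisjoint_strata k W hS hS' ?_
  rintro rfl
  apply hne
  subst hd
  subst hd'
  rfl

theorem mapsTo_cellMap_sphere {n k : ℕ} {W : Submodule ℝ (EuclideanSpace ℝ (Fin n))}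
    (hW : W ∈ grPos (k + 1) n) (d : ℕ) (S : StrataOfDim k W d) :
    Set.MapsTo (cellMap hW S) (sphere 0 1)
      (⋃ (m < d) (T : StrataOfDim k W m), cellMap hW T '' closedBall 0 1) := by
  intro x hx
  obtain ⟨S', hS', hd', hx'⟩ := (cellMap_spec hW S).2.2.2 x hx
  simp only [Set.mem_iUnion]
  refine ⟨dim S', hd', ⟨S', hS', rfl⟩, Set.image_mono ball_subset_closedBall ?_⟩
  rw [(cellMap_spec hW _).2.2.1]
  exact hx'

theorem iUnion_cellMap {n k : ℕ} {W : Submodule ℝ (EuclideanSpace ℝ (Fin n))}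
    (hW : W ∈ grPos (k + 1) n) :
    ⋃ (d : ℕ) (S : StrataOfDim k W d), cellMap hW S '' closedBall 0 1 = amplituhedron k W := by
  rw [← sUnion_strata hW]
  refine Set.Subset.antisymm (Set.iUnion₂_subset fun d S => ?_) ?_
  · rintro _ ⟨x, hx, rfl⟩
    rw [← ball_union_sphere] at hx
    rcases hx with hx | hx
    · refine ⟨S, S.2.1, ?_⟩
      rw [← (cellMap_spec hW S).2.2.1]
      exact ⟨x, hx, rfl⟩
    · obtain ⟨S', hS', -, hx'⟩ := (cellMap_spec hW S).2.2.2 x hx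
      exact ⟨S', hS', hx'⟩
  · rintro X ⟨S, hS, hX⟩
    simp only [Set.mem_iUnion]
    refine ⟨dim S, ⟨S, hS, rfl⟩, Set.image_mono ball_subset_closedBall ?_⟩
    rw [(cellMap_spec hW _).2.2.1]
    exact hX

theorem eventually_isEmpty_strataOfDim {n k : ℕ} {W : Submodule ℝ (EuclideanSpace ℝ (Fin n))}
    (hW : W ∈ grPos (k + 1) n) : ∀ᶠ d in atTop, IsEmpty (StrataOfDim k W d) := by
  filter_upwards [eventually_gt_atTop k] with d hd
  refine ⟨fun S => ?_⟩
  have := dim_le hW S.2.1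
  rw [S.2.2] at this
  omega

/-- The cell structure of the amplituhedron given by the strata. -/
@[reducible]
def cwComplex {n k : ℕ} {W : Submodule ℝ (EuclideanSpace ℝ (Fin n))} (hW : W ∈ grPos (k + 1) n) :
    CWComplex (amplituhedron k W) :=
  CWComplex.mkFinite (amplituhedron k W) (StrataOfDim k W) (fun _ S => cellMap hW S)
    (eventually_isEmpty_strataOfDim hW) (finite_strataOfDim k W) (fun _ S => cellMap_source hW S)
    (fun _ S => (cellMap_spec hW S).1.continuousOn) (fun _ S => continuousOn_cellMap_symm hW S)
    (pairwiseDisjoint_cellMap hW) (mapsTo_cellMap_sphere hW) (iUnion_cellMap hW)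

theorem cwComplex_finite {n k : ℕ} {W : Submodule ℝ (EuclideanSpace ℝ (Fin n))}
    (hW : W ∈ grPos (k + 1) n) :
    letI := cwComplex hW
    CWComplex.Finite (amplituhedron k W) :=
  CWComplex.finite_mkFinite (amplituhedron k W) (StrataOfDim k W) (fun _ S => cellMap hW S)
    (eventually_isEmpty_strataOfDim hW) (finite_strataOfDim k W) (fun _ S => cellMap_source hW S)
    (fun _ S => (cellMap_spec hW S).1.continuousOn) (fun _ S => continuousOn_cellMap_symm hW S)
    (pairwiseDisjoint_cellMap hW) (mapsTo_cellMap_sphere hW) (iUnion_cellMap hW)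

theorem range_openCell {n k : ℕ} {W : Submodule ℝ (EuclideanSpace ℝ (Fin n))}
    (hW : W ∈ grPos (k + 1) n) (d : ℕ) :
    letI := cwComplex hW
    Set.range (CWComplex.openCell (C := amplituhedron k W) d) =
      {S | S ∈ strata k W ∧ dim S = d} := by
  ext S
  constructor
  · rintro ⟨T, rfl⟩
    have h := (cellMap_spec hW T).2.2.1
    change cellMap hW T '' ball 0 1 ∈ _
    rw [h]
    exact T.2
  · intro hS
    exact ⟨(⟨S, hS⟩ : StrataOfDim k W d), (cellMap_spec hW ⟨S, hS⟩).2.2.1⟩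

/-- At q = -1 the factors (1 + q)^j kill every term with j > 0. -/
theorem sum_neg_one_pow_dim {n k : ℕ} {W : Submodule ℝ (EuclideanSpace ℝ (Fin n))}
    (hW : W ∈ grPos (k + 1) n) : ∑ S ∈ (strata_finite k W).toFinset, (-1 : ℤ) ^ dim S = 1 := by
  have h := congrArg (Polynomial.eval₂ (Nat.castRingHom ℤ) (-1)) (genFun_eq' hW)
  rw [genFun, Polynomial.eval₂_finsetSum, Polynomial.eval₂_finsetSum] at h
  simp only [Polynomial.eval₂_pow, Polynomial.eval₂_X] at h
  rw [h, Finset.sum_eq_single 0]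
  · simp
  · intro j _ hj
    simp [Polynomial.eval₂_mul, Polynomial.eval₂_pow, hj]
  · simp

theorem eulerChar_amplituhedron {n k : ℕ} {W : Submodule ℝ (EuclideanSpace ℝ (Fin n))}
    (hW : W ∈ grPos (k + 1) n) :
    letI := cwComplex hW
    eulerChar (amplituhedron k W) = 1 := by
  classical
  change ∑ᶠ d : ℕ, (-1) ^ d * (Nat.card (StrataOfDim k W d) : ℤ) = 1
  refine Eq.trans ?_ (sum_neg_one_pow_dim hW)
  rw [finsum_eq_sum_of_support_subset (s := Finset.range (k + 1)),
    ← Finset.sum_fiberwise_of_maps_to (t := Finset.range (k + 1)) (g := dim)]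
  · refine Finset.sum_congr rfl fun d _ => ?_
    have hcard : Nat.card (StrataOfDim k W d) =
        ((strata_finite k W).toFinset.filter fun S => dim S = d).card :=
      Nat.subtype_card _ fun S => by simp
    have hsum : ∑ S ∈ (strata_finite k W).toFinset with dim S = d, (-1 : ℤ) ^ dim S =
        ∑ S ∈ (strata_finite k W).toFinset with dim S = d, (-1 : ℤ) ^ d :=
      Finset.sum_congr rfl fun S hS => by rw [(Finset.mem_filter.1 hS).2]
    rw [hsum, Finset.sum_const, nsmul_eq_mul, mul_comm, hcard]
  · intro S hS
    exact Finset.mem_range.2 (Nat.lt_succ_of_le (dim_le hW (by simpa using hS)))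
  · intro d hd
    by_contra hc
    apply hd
    have : IsEmpty (StrataOfDim k W d) := ⟨fun S => hc (by
      have := dim_le hW S.2.1
      rw [S.2.2] at this
      simpa [Nat.lt_succ_iff] using this)⟩
    simp [Nat.card_of_isEmpty]

end

end Amplituhedron
end

theorem mainTheorem10 (n k : ℕ) (W : Submodule ℝ (EuclideanSpace ℝ (Fin n)))
    (hW : W ∈ Amplituhedron.grPos (k + 1) n) :
    -- the strata are nonempty and partition the amplituhedron
    (∅ ∉ Amplituhedron.strata k W ∧
      (Amplituhedron.strata k W).PairwiseDisjoint id ∧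
      ⋃₀ Amplituhedron.strata k W = Amplituhedron.amplituhedron k W) ∧
    -- the two formulas for the generating function
    Amplituhedron.genFun k W =
      ∑ i ∈ Finset.range (k + 1),
        Polynomial.C ((n - k - 1 + i).choose i * n.choose (k - i)) * Polynomial.X ^ i ∧
    Amplituhedron.genFun k W =
      ∑ j ∈ Finset.range (k + 1),
        Polynomial.C ((n - k - 1 + j).choose j) * (1 + Polynomial.X) ^ j ∧
    -- the strata are the open cells of a finite CW structure, with Euler characteristic one
    ∃ _ : Topology.CWComplex (Amplituhedron.amplituhedron k W),
      Topology.CWComplex.Finite (Amplituhedron.amplituhedron k W) ∧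
      (∀ d : ℕ, Set.range (Topology.CWComplex.openCell
          (C := Amplituhedron.amplituhedron k W) d) =
        {S | S ∈ Amplituhedron.strata k W ∧ Amplituhedron.dim S = d}) ∧
      Amplituhedron.eulerChar (Amplituhedron.amplituhedron k W) = 1 := by
  refine ⟨⟨?_, Amplituhedron.pairwiseDisjoint_strata k W, Amplituhedron.sUnion_strata hW⟩,
    Amplituhedron.genFun_eq hW, Amplituhedron.genFun_eq' hW, Amplituhedron.cwComplex hW,
    Amplituhedron.cwComplex_finite hW, Amplituhedron.range_openCell hW,
    Amplituhedron.eulerChar_amplituhedron hW⟩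
  rintro ⟨σ, hσ, hk, h⟩
  exact (Amplituhedron.stratum_nonempty hW hσ hk).ne_empty h.symm
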